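/- Let $T$ be an infinite, locally finite tree with root $r$ whose edges are oriented away from $r$, and let $\ell$ be a function that assigns to every edge of $T$ a positive real length. Assume that $(T,\ell)$ is weakly complete: for every vertex $v$, every infinite oriented path starting at $v$ whose interior vertices are all non-branching (i.e. have at most one child) has infinite $\ell$-length. The extended boundary $\widetilde\partial T$ is the set of all infinite oriented paths starting at $r$ and all oriented paths from $r$ to a leaf. For distinct $\rho,\tau\in\widetilde\partial T$ let $\langle\rho,\tau\rangle$ be the total length of the edges common to $\rho$ and $\tau$. Choose $\rho_0\in\widetilde\partial T$ arbitrarily and, inductively, choose $\rho_n$ among the elements $\rho\in\widetilde\partial T\setminus\{\rho_0,\dots,\rho_{n-1}\}$ that minimize $\sum_{j<n}\langle\rho,\rho_j\rangle$. Put $n!_{(T,\ell)}:=\sum_{j<n}\langle\rho_n,\rho_j\rangle$, and $n!_{(T,\ell)}:=\infty$ if $\widetilde\partial T$ has at most $n$ elements. Let $RW(T,\ell)$ be the random walk on the vertices of $T$ that starts at $r$ and moves from $u$ to a neighbour $v$ with probability $c(u,v)/\sum_{w\sim u}c(u,w)$, where $c(u,v)=1/\ell(uv)$. It is called transient if almost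 surely it visits $r$ only finitely many times, and recurrent otherwise. Then the value of $n!_{(T,\ell)}$ does not depend on the choices made, the limit $$H(T,\ell)=\lim_{n\to\infty}\frac1n\,n!_{(T,\ell)}\in[0,\infty]$$ exists, and $RW(T,\ell)$ is transient if and only if $H(T,\ell)<\infty$. Equivalently, $RW(T,\ell)$ is recurrent if and only if $H(T,\ell)=\infty$. -/

import Mathlib

open scoped ENNReal
open MeasureTheory ProbabilityTheory Filter Topology

namespace RootedTree

variable {V : Type*}

/-- In the tree `G` rooted at `r`, the vertex `v` is a child of `u`: the edge `uv` is oriented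
away from the root. -/
def IsChild (G : SimpleGraph V) (r u v : V) : Prop :=
  G.Adj u v ∧ G.dist r v = G.dist r u + 1

/-- A vertex with at least two children. -/
def IsBranching (G : SimpleGraph V) (r u : V) : Prop :=
  {v | IsChild G r u v}.Nontrivial

/-- A leaf: a vertex without children. In a tree this means a non-root vertex of valence one,
or the root if it is the only vertex. -/
def IsLeaf (G : SimpleGraph V) (r u : V) : Prop :=
  ∀ v, ¬ IsChild G r u v

/-- `s` is an infinite oriented path (each vertex is followed by one of its children)
that starts at `v`. -/
def IsRay (G : SimpleGraph V) (r v : V) (s : ℕ → V) : Prop :=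
  s 0 = v ∧ ∀ k, IsChild G r (s k) (s (k + 1))

/-- The pair `(G, ℓ)` is weakly complete: for every vertex `v`, every infinite oriented path from
`v` without branching vertices in its interior has infinite length. -/
def WeaklyComplete (G : SimpleGraph V) (r : V) (ℓ : Sym2 V → ℝ) : Prop :=
  ∀ (v : V) (s : ℕ → V), IsRay G r v s → (∀ k, ¬ IsBranching G r (s (k + 1))) →
    ∑' k, ENNReal.ofReal (ℓ s(s k, s (k + 1))) = ∞

/-- The extended boundary: infinite oriented paths from the root, together with the oriented paths
from the root to a leaf (such a path being given by its leaf). -/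
def ExtBoundary (G : SimpleGraph V) (r : V) : Type _ :=
  {s : ℕ → V // IsRay G r r s} ⊕ {v : V // IsLeaf G r v}

/-- The set `E(ρ)` of the edges on an element `ρ` of the extended boundary. -/
def ExtBoundary.edges {G : SimpleGraph V} {r : V} : ExtBoundary G r → Set (Sym2 V)
  | .inl s => {e | ∃ k, e = s(s.1 k, s.1 (k + 1))}
  | .inr v => {e | ∃ p : G.Walk r v.1, p.IsPath ∧ e ∈ p.edges}

/-- The intersection pairing `⟨ρ, τ⟩`, the total length of the common edges. It is finite
if `ρ ≠ τ`. -/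
noncomputable def pairing {G : SimpleGraph V} {r : V} (ℓ : Sym2 V → ℝ)
    (ρ τ : ExtBoundary G r) : ℝ≥0∞ :=
  ∑' e : ↥(ρ.edges ∩ τ.edges), ENNReal.ofReal (ℓ e.1)

/-- `ρ 0, …, ρ n` is an outcome of the greedy procedure: each `ρ k` is different from all the
earlier ones, and among the elements of the extended boundary with this property it minimizes
the sum of the pairings with the earlier ones. (The values of `ρ` after `n` play no role.) -/
def IsFactorialDefining {G : SimpleGraph V} {r : V} (ℓ : Sym2 V → ℝ)
    (ρ : ℕ → ExtBoundary G r) (n : ℕ) : Prop :=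
  ∀ k ≤ n, (∀ j < k, ρ k ≠ ρ j) ∧
    ∀ σ : ExtBoundary G r, (∀ j < k, σ ≠ ρ j) →
      ∑ j ∈ Finset.range k, pairing ℓ (ρ k) (ρ j) ≤ ∑ j ∈ Finset.range k, pairing ℓ σ (ρ j)

/-- The factorial `n!` of `(G, ℓ)`: the sum of the pairings of the `n`-th term of the greedy
procedure with the earlier terms. All outcomes of the procedure give the same value (this is part
of the theorem), so the infimum is over a set with at most one value; it is `∞`
if the extended boundary has at most `n` elements, so that the procedure stops earlier. -/
noncomputable def factorial (G : SimpleGraph V) (r : V) (ℓ : Sym2 V → ℝ) (n : ℕ) : ℝ≥0∞ :=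
  ⨅ (ρ : ℕ → ExtBoundary G r) (_ : IsFactorialDefining ℓ ρ n),
    ∑ j ∈ Finset.range n, pairing ℓ (ρ n) (ρ j)

open Classical in
/-- The conductance `1 / ℓ(uv)` of an edge `uv`; zero if `u` and `v` are not adjacent. -/
noncomputable def conductance (G : SimpleGraph V) (ℓ : Sym2 V → ℝ) (u v : V) : ℝ≥0∞ :=
  if G.Adj u v then ENNReal.ofReal (1 / ℓ s(u, v)) else 0

open Classical in
/-- One step of the random walk from `u`: it goes to `v` with probability
`c(u,v) / ∑ w, c(u,w)`. (The second case does not occur at a vertex that has a neighbour, has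
finitely many of them, and whose edges have positive lengths.) -/
noncomputable def stepPMF (G : SimpleGraph V) (ℓ : Sym2 V → ℝ) (u : V) : PMF V :=
  if h : ∑' w, conductance G ℓ u w ≠ 0 ∧ ∑' w, conductance G ℓ u w ≠ ∞ then
    PMF.normalize (conductance G ℓ u) h.1 h.2
  else PMF.pure u

/-- The transition kernel that gives the position at time `n + 1` from the positions up to
time `n`: a step from the position at time `n`. -/
noncomputable def stepKernel [MeasurableSpace V] [DiscreteMeasurableSpace V]
    (G : SimpleGraph V) (ℓ : Sym2 V → ℝ) (n : ℕ) : Kernel (Finset.Iic n → V) V :=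
  Kernel.comap ⟨fun u => (stepPMF G ℓ u).toMeasure, Measurable.of_discrete⟩
    (fun x => x ⟨n, Finset.mem_Iic.2 le_rfl⟩) (measurable_pi_apply _)

instance [MeasurableSpace V] [DiscreteMeasurableSpace V]
    (G : SimpleGraph V) (ℓ : Sym2 V → ℝ) (n : ℕ) : IsMarkovKernel (stepKernel G ℓ n) :=
  ⟨fun x => PMF.toMeasure.isProbabilityMeasure (stepPMF G ℓ (x ⟨n, Finset.mem_Iic.2 le_rfl⟩))⟩

/-- The law, on the space of trajectories `ℕ → V`, of the random walk with conductances `1 / ℓ`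
that starts at `r`. -/
noncomputable def walkLaw [MeasurableSpace V] [DiscreteMeasurableSpace V]
    (G : SimpleGraph V) (r : V) (ℓ : Sym2 V → ℝ) : Measure (ℕ → V) :=
  Kernel.traj (X := fun _ => V) (stepKernel G ℓ) 0 (fun _ => r)

/-- Almost surely, the walk is at the root only finitely many times. -/
def Transient [MeasurableSpace V] [DiscreteMeasurableSpace V]
    (G : SimpleGraph V) (r : V) (ℓ : Sym2 V → ℝ) : Prop :=
  ∀ᵐ X ∂(walkLaw G r ℓ), {n : ℕ | X n = r}.Finite

/-- The walk is not transient. -/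
def Recurrent [MeasurableSpace V] [DiscreteMeasurableSpace V]
    (G : SimpleGraph V) (r : V) (ℓ : Sym2 V → ℝ) : Prop :=
  ¬ Transient G r ℓ

end RootedTree

/-!
The factorials of a tree with edge lengths, and the type problem for its random walk.

Counting, at each vertex, the members of a finite family of points of the extended boundary that
pass through it turns the family into an integral flow on the tree, and the sum of the pairings of
a point `σ` with the family is the sum along `σ` of this flow weighted by the lengths
(`sum_pairing_eq_tsum`). Two facts govern the greedy procedure. If an injective family `b` is
larger than a family `a`, one descends from the root through vertices with more members of `b` than
of `a` and ends at a member of `b` that is no closer to `a` than to the rest of `b`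
(`exists_sum_pairing_le`). In a greedy sequence, the last point has the largest sum of pairings with
the others (`IsFactorialDefining.sum_erase_le`), because the pairing is an ultrametric similarity
(`min_pairing_le`). Together they say that `n!` is a min-max over all sets of `n + 1` points, so
that it does not depend on the choices, and that it is superadditive in `n` (`factorial_add_le`).
The limit `H` of `n! / n` exists by Fekete's lemma and bounds all quotients.

If the walk is transient, the gradient of the escape probability is a flow of positive strength
whose potential is bounded (`exists_isPotentialFlow`). Given `n` points, some path from the root
meets their flow only where it is dominated by the rescaled flow of the walk; the sum of the
pairings of this path with the `n` points is then at most a constant times `n`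
(`IsPotentialFlow.exists_sum_pairing_le`). If the path is one of the given points, it has
finite length, and weak completeness yields a path that branches off from it far away and
is no closer to the given points (`exists_branchOff`). Hence `H` is finite.

If `H` is finite, the flows of the greedy sequences, divided by `n`, approximate a unit flow of
energy at most `H`. By the Cauchy–Schwarz inequality a function `φ ≥ 0` of finite support satisfies
`φ(r)² ≤ H D(φ)`, where `D` is the Dirichlet energy (`sq_apply_root_le`). For the truncated Green
function `φ`, the Green formula gives `D(φ) ≤ π(r) φ(r)` with the total conductance `π(r)` at the
root, so the Green function at the root is at most `H π(r)` (`sum_returnProb_le`), and the walk is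
transient by the Borel–Cantelli lemma.
-/

namespace RootedTree

variable {V : Type*} {G : SimpleGraph V} {r : V}

/-! ### Parents and geodesics in a rooted tree -/

lemma IsChild.parent_unique (hG : G.IsTree) {u u' v : V} (h : IsChild G r u v)
    (h' : IsChild G r u' v) : u = u' := by
  obtain ⟨p, hp⟩ := hG.connected.exists_walk_length_eq_dist r u
  obtain ⟨q, hq⟩ := hG.connected.exists_walk_length_eq_dist r u'
  have h1 : (p.concat h.1).IsPath := SimpleGraph.Walk.isPath_of_length_eq_dist _ (by
    rw [SimpleGraph.Walk.length_concat, hp, h.2])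
  have h2 : (q.concat h'.1).IsPath := SimpleGraph.Walk.isPath_of_length_eq_dist _ (by
    rw [SimpleGraph.Walk.length_concat, hq, h'.2])
  have h3 := (hG.existsUnique_path r v).unique h1 h2
  have h4 := congrArg SimpleGraph.Walk.penultimate h3
  simpa using h4

lemma isChild_or_isChild_of_adj (hG : G.IsTree) {u v : V} (h : G.Adj u v) :
    IsChild G r u v ∨ IsChild G r v u := by
  rcases hG.dist_eq_dist_add_one_of_adj r h with h1 | h1
  · exact Or.inr ⟨h.symm, h1⟩
  · exact Or.inl ⟨h, h1⟩

lemma exists_isChild_of_ne (hG : G.IsTree) {v : V} (hv : v ≠ r) : ∃ u, IsChild G r u v := by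
  obtain ⟨p, hp⟩ := hG.connected.exists_walk_length_eq_dist v r
  cases p with
  | nil => exact absurd rfl hv
  | @cons _ u _ h p =>
    refine ⟨u, h.symm, ?_⟩
    have h1 := SimpleGraph.dist_le p
    rw [SimpleGraph.Walk.length_cons, SimpleGraph.dist_comm] at hp
    rw [SimpleGraph.dist_comm] at h1
    rcases hG.dist_eq_dist_add_one_of_adj r h with h2 | h2 <;> omega

lemma IsChild.ne_root {u v : V} (h : IsChild G r u v) : v ≠ r := by
  rintro rfl
  have := h.2
  simp at this

open Classical in
/-- The parent of a vertex. By convention the root is its own parent. -/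
noncomputable def parent (G : SimpleGraph V) (r v : V) : V :=
  if h : ∃ u, IsChild G r u v then h.choose else v

lemma isChild_parent (hG : G.IsTree) {v : V} (hv : v ≠ r) : IsChild G r (parent G r v) v := by
  have h := exists_isChild_of_ne hG hv
  rw [parent, dif_pos h]
  exact h.choose_spec

lemma IsChild.parent_eq (hG : G.IsTree) {u v : V} (h : IsChild G r u v) : parent G r v = u :=
  (isChild_parent hG h.ne_root).parent_unique hG h

lemma dist_parent (hG : G.IsTree) {v : V} (hv : v ≠ r) :
    G.dist r v = G.dist r (parent G r v) + 1 :=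
  (isChild_parent hG hv).2

lemma dist_eq_zero (hG : G.IsTree) {v : V} : G.dist r v = 0 ↔ v = r := by
  rw [hG.connected.dist_eq_zero_iff, eq_comm]

lemma dist_iterate_parent (hG : G.IsTree) (v : V) {k : ℕ} (hk : k ≤ G.dist r v) :
    G.dist r ((parent G r)^[k] v) = G.dist r v - k := by
  induction k with
  | zero => simp
  | succ k ih =>
    have ih := ih (by omega)
    rw [Function.iterate_succ_apply']
    have hne : (parent G r)^[k] v ≠ r := by
      rw [Ne, ← dist_eq_zero hG, ih]
      omega
    have := dist_parent hG hne
    omega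

/-- The geodesic from the root to `v` runs through the iterated parents of `v`. -/
lemma exists_walk_edges (hG : G.IsTree) (n : ℕ) : ∀ v : V, G.dist r v = n →
    ∃ p : G.Walk r v, p.length = n ∧
      ∀ e, e ∈ p.edges ↔ ∃ i < n, e = s((parent G r)^[i + 1] v, (parent G r)^[i] v) := by
  induction n with
  | zero =>
    intro v hv
    obtain rfl := (dist_eq_zero hG).1 hv
    exact ⟨.nil, rfl, by simp⟩
  | succ n ih =>
    intro v hv
    have hne : v ≠ r := by
      rintro rfl
      simp at hv
    have hc := isChild_parent hG hne
    obtain ⟨p, hp, hpe⟩ := ih (parent G r v) (by have := hc.2; omega)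
    refine ⟨p.concat hc.1, by simp [hp], fun e => ?_⟩
    rw [SimpleGraph.Walk.edges_concat, List.concat_eq_append, List.mem_append, hpe,
      List.mem_singleton]
    constructor
    · rintro (⟨i, hi, rfl⟩ | rfl)
      · exact ⟨i + 1, by omega, rfl⟩
      · exact ⟨0, by omega, rfl⟩
    · rintro ⟨i, hi, rfl⟩
      cases i with
      | zero => exact Or.inr rfl
      | succ i => exact Or.inl ⟨i, by omega, rfl⟩

/-! ### Elements of the extended boundary as sequences of vertices -/

/-- A descending sequence of vertices: it starts at the root, moves to a child in each step,
and stays for ever at a leaf once it has reached one. -/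
def IsDescent (G : SimpleGraph V) (r : V) (s : ℕ → V) : Prop :=
  s 0 = r ∧ ∀ k, IsChild G r (s k) (s (k + 1)) ∨ IsLeaf G r (s k) ∧ s (k + 1) = s k

/-- The sequence of the vertices of an element of the extended boundary. It is continued by
a constant if the element is given by a leaf. -/
noncomputable def ExtBoundary.pt (ρ : ExtBoundary G r) : ℕ → V :=
  match ρ with
  | .inl s => s.1
  | .inr v => fun k => (parent G r)^[G.dist r v.1 - k] v.1

lemma isDescent_iterate_parent (hG : G.IsTree) {v : V} (hv : IsLeaf G r v) :
    IsDescent G r (fun k => (parent G r)^[G.dist r v - k] v) := by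
  constructor
  · rw [← dist_eq_zero hG, dist_iterate_parent hG v (by omega)]
    omega
  · intro k
    rcases lt_or_ge k (G.dist r v) with hk | hk
    · left
      obtain ⟨j, hj⟩ : ∃ j, G.dist r v - k = j + 1 := ⟨G.dist r v - k - 1, by omega⟩
      have hj' : G.dist r v - (k + 1) = j := by omega
      simp only [hj, hj', Function.iterate_succ_apply']
      apply isChild_parent hG
      rw [Ne, ← dist_eq_zero hG, dist_iterate_parent hG v (by omega)]
      omega
    · right
      have h1 : G.dist r v - k = 0 := by omega
      have h2 : G.dist r v - (k + 1) = 0 := by omega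
      simp only [h1, h2, Function.iterate_zero_apply, and_true]
      exact hv

lemma ExtBoundary.isDescent_pt (hG : G.IsTree) (ρ : ExtBoundary G r) : IsDescent G r ρ.pt := by
  rcases ρ with s | v
  · exact ⟨s.2.1, fun k => Or.inl (s.2.2 k)⟩
  · exact isDescent_iterate_parent hG v.2

namespace IsDescent

variable {s t : ℕ → V}

lemma eq_of_isLeaf (hs : IsDescent G r s) {k : ℕ} (hk : IsLeaf G r (s k)) {j : ℕ} (hj : k ≤ j) :
    s j = s k := by
  induction j, hj using Nat.le_induction with
  | base => rfl
  | succ j hj ih =>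
    rcases hs.2 j with h | h
    · rw [ih] at h
      exact absurd h (hk _)
    · rw [h.2, ih]

lemma dist_eq_or (hs : IsDescent G r s) (k : ℕ) :
    G.dist r (s k) = k ∨ IsLeaf G r (s k) ∧ G.dist r (s k) < k ∧ s (G.dist r (s k)) = s k := by
  induction k with
  | zero => left; rw [hs.1]; simp
  | succ k ih =>
    rcases hs.2 k with h | h
    · rcases ih with h1 | h1
      · left; rw [h.2, h1]
      · exact absurd h (h1.1 _)
    · right
      rw [h.2]
      rcases ih with h1 | h1
      · exact ⟨h.1, by omega, by rw [h1]⟩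
      · exact ⟨h.1, by omega, h1.2.2⟩

lemma dist_le (hs : IsDescent G r s) (k : ℕ) : G.dist r (s k) ≤ k := by
  rcases hs.dist_eq_or k with h | h
  · exact h.le
  · exact h.2.1.le

lemma apply_dist (hs : IsDescent G r s) (k : ℕ) : s (G.dist r (s k)) = s k := by
  rcases hs.dist_eq_or k with h | h
  · rw [h]
  · exact h.2.2

lemma dist_of_not_isLeaf (hs : IsDescent G r s) {k : ℕ} (hk : ¬ IsLeaf G r (s k)) :
    G.dist r (s k) = k :=
  (hs.dist_eq_or k).resolve_right fun h => hk h.1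

lemma isChild_of_lt (hs : IsDescent G r s) {k m : ℕ} (hk : k < G.dist r (s m)) :
    IsChild G r (s k) (s (k + 1)) := by
  rcases hs.2 k with h | h
  · exact h
  · have h1 := hs.dist_le m
    have h2 := hs.dist_le k
    rw [hs.eq_of_isLeaf h.1 (show k ≤ m by omega)] at hk
    omega

lemma parent_apply_succ (hG : G.IsTree) (hs : IsDescent G r s) {k m : ℕ}
    (hk : k < G.dist r (s m)) : parent G r (s (k + 1)) = s k :=
  (hs.isChild_of_lt hk).parent_eq hG

lemma eq_iterate_parent (hG : G.IsTree) (hs : IsDescent G r s) {m k : ℕ}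
    (hk : k ≤ G.dist r (s m)) : s k = (parent G r)^[G.dist r (s m) - k] (s m) := by
  obtain ⟨d, hd⟩ := Nat.exists_eq_add_of_le hk
  rw [hd, Nat.add_sub_cancel_left]
  induction d generalizing k with
  | zero => rw [Function.iterate_zero_apply, ← hs.apply_dist m, hd]; rfl
  | succ d ih =>
    rw [Function.iterate_succ_apply', ← ih (k := k + 1) (by omega) (by omega),
      hs.parent_apply_succ hG (m := m) (by omega)]

lemma agree (hG : G.IsTree) (hs : IsDescent G r s) (ht : IsDescent G r t) {v : V}
    (hv : v ∈ Set.range s) (hv' : v ∈ Set.range t) {k : ℕ} (hk : k ≤ G.dist r v) : s k = t k := by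
  obtain ⟨m, rfl⟩ := hv
  obtain ⟨m', hm'⟩ := hv'
  rw [hs.eq_iterate_parent hG hk, ht.eq_iterate_parent hG (m := m') (by rwa [hm']), hm']

/-- Every descending sequence comes from an element of the extended boundary. -/
lemma exists_pt_eq (hG : G.IsTree) (hs : IsDescent G r s) : ∃ ρ : ExtBoundary G r, ρ.pt = s := by
  by_cases h : ∀ k, IsChild G r (s k) (s (k + 1))
  · exact ⟨.inl ⟨s, hs.1, h⟩, rfl⟩
  · push Not at h
    obtain ⟨k, hk⟩ := h
    have hl := ((hs.2 k).resolve_left hk).1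
    refine ⟨.inr ⟨s k, hl⟩, funext fun i => ?_⟩
    change (parent G r)^[G.dist r (s k) - i] (s k) = s i
    rcases le_or_gt i (G.dist r (s k)) with hi | hi
    · exact (hs.eq_iterate_parent hG hi).symm
    · rw [Nat.sub_eq_zero_of_le hi.le, Function.iterate_zero_apply, ← hs.apply_dist k]
      rw [← hs.apply_dist k] at hl
      exact (hs.eq_of_isLeaf hl hi.le).symm

end IsDescent

namespace ExtBoundary

lemma pt_injective : Function.Injective (pt : ExtBoundary G r → ℕ → V) := by
  intro ρ τ h
  have hleaf (v : {v : V // IsLeaf G r v}) :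
      pt (.inr v : ExtBoundary G r) (G.dist r v.1) = v.1 := by simp [pt]
  have hne (s : {s : ℕ → V // IsRay G r r s}) (v : {v : V // IsLeaf G r v}) :
      pt (.inl s : ExtBoundary G r) ≠ pt (.inr v : ExtBoundary G r) := by
    intro h
    have h1 := s.2.2 (G.dist r v.1)
    rw [show s.1 (G.dist r v.1) = v.1 from (congrFun h _).trans (hleaf v)] at h1
    exact v.2 _ h1
  rcases ρ with s | v <;> rcases τ with t | w
  · exact congrArg Sum.inl (Subtype.ext h)
  · exact absurd h (hne _ _)
  · exact absurd h.symm (hne _ _)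
  · refine congrArg Sum.inr (Subtype.ext ?_)
    have h1 := congrFun h (max (G.dist r v.1) (G.dist r w.1))
    simpa [pt] using h1

/-- The set of the vertices on an element of the extended boundary. -/
def verts (ρ : ExtBoundary G r) : Set V := Set.range ρ.pt

lemma pt_mem_verts (ρ : ExtBoundary G r) (k : ℕ) : ρ.pt k ∈ ρ.verts := ⟨k, rfl⟩

lemma mem_verts_iff (hG : G.IsTree) {ρ : ExtBoundary G r} {v : V} :
    v ∈ ρ.verts ↔ ρ.pt (G.dist r v) = v := by
  constructor
  · rintro ⟨k, rfl⟩
    exact (ρ.isDescent_pt hG).apply_dist k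
  · intro h
    exact ⟨_, h⟩

lemma root_mem_verts (hG : G.IsTree) (ρ : ExtBoundary G r) : r ∈ ρ.verts :=
  ⟨0, (ρ.isDescent_pt hG).1⟩

lemma pt_eq_pt (hG : G.IsTree) {ρ τ : ExtBoundary G r} {v : V} (hρ : v ∈ ρ.verts)
    (hτ : v ∈ τ.verts) {k : ℕ} (hk : k ≤ G.dist r v) : ρ.pt k = τ.pt k :=
  (ρ.isDescent_pt hG).agree hG (τ.isDescent_pt hG) hρ hτ hk

/-- If `ρ` and `τ` meet at `v`, then every vertex of `ρ` above `v` lies on `τ`. -/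
lemma mem_verts_of_dist_le (hG : G.IsTree) {ρ τ : ExtBoundary G r} {v w : V} (hρ : v ∈ ρ.verts)
    (hτ : v ∈ τ.verts) (hw : w ∈ ρ.verts) (hd : G.dist r w ≤ G.dist r v) : w ∈ τ.verts := by
  refine ⟨G.dist r w, ?_⟩
  rw [← pt_eq_pt hG hρ hτ hd]
  exact (mem_verts_iff hG).1 hw

lemma mem_verts_of_isChild (hG : G.IsTree) {ρ : ExtBoundary G r} {u v : V} (h : IsChild G r u v)
    (hv : v ∈ ρ.verts) : u ∈ ρ.verts := by
  obtain ⟨m, rfl⟩ := hv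
  have hd := h.2
  have h1 := ((ρ.isDescent_pt hG).isChild_of_lt
    (show G.dist r u < G.dist r (ρ.pt m) by omega))
  rw [← hd, (ρ.isDescent_pt hG).apply_dist m] at h1
  exact ⟨_, h1.parent_unique hG h⟩

lemma isChild_unique (hG : G.IsTree) {ρ : ExtBoundary G r} {u v w : V} (hv : IsChild G r u v)
    (hw : IsChild G r u w) (hvρ : v ∈ ρ.verts) (hwρ : w ∈ ρ.verts) : v = w := by
  rw [← (mem_verts_iff hG).1 hvρ, ← (mem_verts_iff hG).1 hwρ, hv.2, hw.2]

lemma exists_isChild_mem (hG : G.IsTree) {ρ : ExtBoundary G r} {u : V} (hu : u ∈ ρ.verts)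
    (h : ¬ IsLeaf G r u) : ∃ v ∈ ρ.verts, IsChild G r u v := by
  obtain ⟨m, rfl⟩ := hu
  refine ⟨ρ.pt (m + 1), ⟨_, rfl⟩, ?_⟩
  exact ((ρ.isDescent_pt hG).2 m).resolve_right fun h' => h h'.1

lemma eq_of_verts_subset (hG : G.IsTree) {ρ τ : ExtBoundary G r} (h : ∀ k, ρ.pt k ∈ τ.verts) :
    ρ = τ := by
  by_cases hl : ∃ k, IsLeaf G r (ρ.pt k)
  · obtain ⟨k, hk⟩ := hl
    apply pt_injective
    funext i
    set d := G.dist r (ρ.pt k) with hd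
    rcases le_or_gt i d with hi | hi
    · exact pt_eq_pt hG (pt_mem_verts ρ k) (h k) hi
    · have h1 : ρ.pt d = ρ.pt k := (ρ.isDescent_pt hG).apply_dist k
      have h2 : τ.pt d = ρ.pt k := (mem_verts_iff hG).1 (h k)
      rw [(ρ.isDescent_pt hG).eq_of_isLeaf (by rwa [h1]) hi.le,
        (τ.isDescent_pt hG).eq_of_isLeaf (by rwa [h2]) hi.le, h1, h2]
  · push Not at hl
    apply pt_injective
    funext i
    exact pt_eq_pt hG (pt_mem_verts ρ i) (h i)
      ((ρ.isDescent_pt hG).dist_of_not_isLeaf (hl i)).ge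

lemma eq_of_isLeaf_mem (hG : G.IsTree) {ρ τ : ExtBoundary G r} {v : V} (hv : IsLeaf G r v)
    (hρ : v ∈ ρ.verts) (hτ : v ∈ τ.verts) : ρ = τ := by
  apply eq_of_verts_subset hG
  intro k
  have h1 := (mem_verts_iff hG).1 hρ
  rcases le_or_gt k (G.dist r v) with hk | hk
  · rw [pt_eq_pt hG hρ hτ hk]
    exact ⟨k, rfl⟩
  · rw [(ρ.isDescent_pt hG).eq_of_isLeaf (by rwa [h1]) hk.le, h1]
    exact hτ

/-- Once `σ` has left `τ` it does not come back. -/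
lemma pt_notMem_of_le (hG : G.IsTree) {σ τ : ExtBoundary G r} {k m : ℕ} (h : σ.pt k ∉ τ.verts)
    (hkm : k ≤ m) : σ.pt m ∉ τ.verts := by
  intro hm
  refine h (mem_verts_of_dist_le hG (pt_mem_verts σ m) hm (pt_mem_verts σ k) ?_)
  rcases (σ.isDescent_pt hG).dist_eq_or m with h1 | h1
  · rw [h1]; exact ((σ.isDescent_pt hG).dist_le k).trans hkm
  · rcases le_or_gt k (G.dist r (σ.pt m)) with h2 | h2
    · exact ((σ.isDescent_pt hG).dist_le k).trans h2
    · rw [(σ.isDescent_pt hG).eq_of_isLeaf (k := G.dist r (σ.pt m)) (by rw [h1.2.2]; exact h1.1)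
        h2.le, h1.2.2]

/-- A point of the extended boundary eventually leaves finitely many others. -/
lemma exists_forall_pt_notMem (hG : G.IsTree) {ι : Type*} (s : Finset ι) (a : ι → ExtBoundary G r)
    {σ : ExtBoundary G r} (h : ∀ i ∈ s, σ ≠ a i) : ∃ k, ∀ i ∈ s, σ.pt k ∉ (a i).verts := by
  have h1 : ∀ i, ∃ k, i ∈ s → σ.pt k ∉ (a i).verts := by
    intro i
    by_cases hi : i ∈ s
    · by_contra! hcon
      exact h i hi (eq_of_verts_subset hG fun k => (hcon k).2)
    · exact ⟨0, fun h => absurd h hi⟩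
  choose k hk using h1
  exact ⟨s.sup k, fun i hi => pt_notMem_of_le hG (hk i hi) (Finset.le_sup hi)⟩

/-- A property of vertices that holds at the root, and that is inherited by at least one child of
each vertex with children, holds along some element of the extended boundary. -/
lemma exists_forall_pt (hG : G.IsTree) (P : V → Prop) (h0 : P r)
    (hP : ∀ v, P v → ¬ IsLeaf G r v → ∃ w, IsChild G r v w ∧ P w) :
    ∃ σ : ExtBoundary G r, ∀ k, P (σ.pt k) := by
  classical
  have hnext : ∀ v : {v // P v}, ∃ w : {v // P v},
      IsChild G r v.1 w.1 ∨ IsLeaf G r v.1 ∧ w = v := by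
    rintro ⟨v, hv⟩
    by_cases hl : IsLeaf G r v
    · exact ⟨⟨v, hv⟩, Or.inr ⟨hl, rfl⟩⟩
    · obtain ⟨w, hw, hw'⟩ := hP v hv hl
      exact ⟨⟨w, hw'⟩, Or.inl hw⟩
  choose next hnext using hnext
  let s : ℕ → {v // P v} := fun k => next^[k] ⟨r, h0⟩
  have hs : IsDescent G r (fun k => (s k).1) := by
    refine ⟨rfl, fun k => ?_⟩
    have h := hnext (s k)
    simp only [s, Function.iterate_succ_apply'] at h ⊢
    exact h.imp_right fun h => ⟨h.1, congrArg Subtype.val h.2⟩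
  obtain ⟨σ, hσ⟩ := hs.exists_pt_eq hG
  exact ⟨σ, fun k => by rw [hσ]; exact (s k).2⟩

/-- Every vertex lies on some element of the extended boundary. -/
lemma exists_mem_verts (hG : G.IsTree) (v : V) : ∃ σ : ExtBoundary G r, v ∈ σ.verts := by
  have hroot : (parent G r)^[G.dist r v] v = r := by
    rw [← dist_eq_zero hG, dist_iterate_parent hG v le_rfl, Nat.sub_self]
  obtain ⟨σ, hσ⟩ := exists_forall_pt (r := r) hG
    (fun w => G.dist r w ≤ G.dist r v → (parent G r)^[G.dist r v - G.dist r w] v = w)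
    (by simpa using hroot) (by
      intro u hu hl
      rcases lt_or_ge (G.dist r u) (G.dist r v) with h | h
      · have hu := hu h.le
        obtain ⟨j, hj⟩ : ∃ j, G.dist r v - G.dist r u = j + 1 :=
          ⟨G.dist r v - G.dist r u - 1, by omega⟩
        have hd : G.dist r ((parent G r)^[j] v) = G.dist r u + 1 := by
          rw [dist_iterate_parent hG v (by omega)]; omega
        refine ⟨(parent G r)^[j] v, ?_, fun _ => by rw [hd]; congr 1; omega⟩
        have := isChild_parent (r := r) hG (v := (parent G r)^[j] v) (by
          rw [Ne, ← dist_eq_zero hG, hd]; omega)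
        rwa [← Function.iterate_succ_apply' (parent G r), Nat.succ_eq_add_one, ← hj, hu] at this
      · rw [IsLeaf] at hl
        push Not at hl
        obtain ⟨w, hw⟩ := hl
        exact ⟨w, hw, fun h' => by have := hw.2; omega⟩)
  refine ⟨σ, ?_⟩
  by_contra hv
  -- The point of `σ` at the level of `v` is `v`, unless `σ` ends at a leaf above that level.
  rcases (σ.isDescent_pt hG).dist_eq_or (G.dist r v) with h | h
  · have h1 := hσ (G.dist r v) h.le
    rw [h, Nat.sub_self, Function.iterate_zero_apply] at h1
    exact hv ⟨_, h1.symm⟩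
  · have h1 := hσ (G.dist r v) h.2.1.le
    obtain ⟨j, hj⟩ : ∃ j, G.dist r v - G.dist r (σ.pt (G.dist r v)) = j + 1 :=
      ⟨G.dist r v - G.dist r (σ.pt (G.dist r v)) - 1, by omega⟩
    rw [hj, Function.iterate_succ_apply'] at h1
    have h2 := isChild_parent (r := r) hG (v := (parent G r)^[j] v) (by
      rw [Ne, ← dist_eq_zero hG, dist_iterate_parent hG v (by omega)]; omega)
    rw [h1] at h2
    exact h.1 _ h2

end ExtBoundary

/-! ### The pairing as a sum over vertices -/

open Classical in
/-- The length of the edge between a vertex and its parent; it is `0` at the root. -/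
noncomputable def edgeLength (G : SimpleGraph V) (r : V) (ℓ : Sym2 V → ℝ) (v : V) : ℝ≥0∞ :=
  if v = r then 0 else ENNReal.ofReal (ℓ s(parent G r v, v))

namespace ExtBoundary

lemma edges_eq (hG : G.IsTree) (ρ : ExtBoundary G r) :
    ρ.edges = (fun v => s(parent G r v, v)) '' {v | v ≠ r ∧ v ∈ ρ.verts} := by
  rcases ρ with s | v
  · ext e
    constructor
    · rintro ⟨k, rfl⟩
      exact ⟨s.1 (k + 1), ⟨(s.2.2 k).ne_root, ⟨k + 1, rfl⟩⟩, by simp only [(s.2.2 k).parent_eq hG]⟩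
    · rintro ⟨v, ⟨hv, ⟨k, rfl⟩⟩, rfl⟩
      cases k with
      | zero => exact absurd s.2.1 hv
      | succ k => exact ⟨k, by
          simp only [show pt (.inl s : ExtBoundary G r) (k + 1) = s.1 (k + 1) from rfl,
            (s.2.2 k).parent_eq hG]⟩
  · obtain ⟨p, hp, hpe⟩ := exists_walk_edges (r := r) hG _ v.1 rfl
    have hpp : p.IsPath := p.isPath_of_length_eq_dist hp
    have hset : edges (.inr v : ExtBoundary G r) = {e | e ∈ p.edges} := by
      ext e
      constructor
      · rintro ⟨q, hq, he⟩
        rwa [(hG.existsUnique_path r v.1).unique hq hpp] at he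
      · intro he
        exact ⟨p, hpp, he⟩
    rw [hset]
    ext e
    rw [Set.mem_ofPred_eq, hpe]
    constructor
    · rintro ⟨i, hi, rfl⟩
      refine ⟨(parent G r)^[i] v.1, ⟨?_, ⟨G.dist r v.1 - i, ?_⟩⟩, ?_⟩
      · rw [Ne, ← dist_eq_zero hG, dist_iterate_parent hG _ hi.le]; omega
      · change (parent G r)^[G.dist r v.1 - (G.dist r v.1 - i)] v.1 = _
        congr 1
        omega
      · simp only [Function.iterate_succ_apply']
    · rintro ⟨w, ⟨hw, ⟨k, rfl⟩⟩, rfl⟩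
      refine ⟨G.dist r v.1 - k, ?_, ?_⟩
      · by_contra hk
        apply hw
        change (parent G r)^[G.dist r v.1 - k] v.1 = r
        rw [← dist_eq_zero hG, dist_iterate_parent hG _ (by omega)]
        omega
      · simp only [Function.iterate_succ_apply']
        rfl

end ExtBoundary

lemma parent_edge_injOn (hG : G.IsTree) :
    Set.InjOn (fun v => s(parent G r v, v)) {v | v ≠ r} := by
  intro v hv w hw h
  rcases Sym2.eq_iff.1 h with h | h
  · exact h.2
  · have h1 := dist_parent hG hv
    have h2 := dist_parent hG hw
    rw [h.1] at h1
    rw [← h.2] at h2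
    omega

open Classical in
lemma pairing_eq_tsum (hG : G.IsTree) (ℓ : Sym2 V → ℝ) (ρ τ : ExtBoundary G r) :
    pairing ℓ ρ τ = ∑' v, if v ∈ ρ.verts ∧ v ∈ τ.verts then edgeLength G r ℓ v else 0 := by
  have hset : ρ.edges ∩ τ.edges =
      (fun v => s(parent G r v, v)) '' {v | v ≠ r ∧ v ∈ ρ.verts ∧ v ∈ τ.verts} := by
    rw [ρ.edges_eq hG, τ.edges_eq hG, ← (parent_edge_injOn (r := r) hG).image_inter
      (fun v hv => hv.1) (fun v hv => hv.1)]
    congr 1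
    ext v
    simp only [Set.mem_inter_iff, Set.mem_ofPred_eq]
    tauto
  rw [pairing, hset, tsum_image (f := fun e => ENNReal.ofReal (ℓ e))
    ((parent_edge_injOn (r := r) hG).mono fun v hv => hv.1),
    tsum_subtype _ (fun v => ENNReal.ofReal (ℓ s(parent G r v, v)))]
  refine tsum_congr fun v => ?_
  simp only [Set.indicator_apply, Set.mem_ofPred_eq, edgeLength]
  by_cases hv : v = r <;> simp [hv]

lemma pairing_comm (ℓ : Sym2 V → ℝ) (ρ τ : ExtBoundary G r) : pairing ℓ ρ τ = pairing ℓ τ ρ := by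
  rw [pairing, pairing, Set.inter_comm]

/-- Geodesics in a tree branch off for good, so the pairing is an ultrametric similarity. -/
lemma min_pairing_le (hG : G.IsTree) (ℓ : Sym2 V → ℝ) (x y z : ExtBoundary G r) :
    min (pairing ℓ x y) (pairing ℓ y z) ≤ pairing ℓ x z := by
  have key (x z : ExtBoundary G r) (h : ∀ v, v ∈ x.verts → v ∈ y.verts → v ∈ z.verts) :
      pairing ℓ x y ≤ pairing ℓ x z := by
    rw [pairing_eq_tsum hG, pairing_eq_tsum hG]
    refine ENNReal.tsum_le_tsum fun v => ?_
    by_cases hv : v ∈ x.verts ∧ v ∈ y.verts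
    · rw [if_pos hv, if_pos ⟨hv.1, h v hv.1 hv.2⟩]
    · simp [hv]
  by_cases h : ∀ v, v ∈ x.verts → v ∈ y.verts → v ∈ z.verts
  · exact (min_le_left _ _).trans (key x z h)
  · push Not at h
    obtain ⟨v, hvx, hvy, hvz⟩ := h
    refine (min_le_right _ _).trans ?_
    rw [pairing_comm ℓ y z, pairing_comm ℓ x z]
    refine key z x fun w hwz hwy => ?_
    rcases le_total (G.dist r w) (G.dist r v) with hd | hd
    · exact ExtBoundary.mem_verts_of_dist_le hG hvy hvx hwy hd
    · exact absurd (ExtBoundary.mem_verts_of_dist_le hG hwy hwz hvy hd) hvz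

/-! ### Counting the members of a family that pass through a vertex -/

open Classical in
/-- The number of the members of a finite family of points of the extended boundary that pass
through the vertex `v`. -/
noncomputable def passCount {ι : Type*} (s : Finset ι) (a : ι → ExtBoundary G r) (v : V) : ℕ :=
  (s.filter fun i => v ∈ (a i).verts).card

section passCount

variable {ι : Type*} {s : Finset ι} {a : ι → ExtBoundary G r}

lemma passCount_root (hG : G.IsTree) : passCount s a r = s.card := by
  classical
  rw [passCount, Finset.filter_true_of_mem fun i _ => (a i).root_mem_verts hG]

lemma passCount_eq_zero {v : V} : passCount s a v = 0 ↔ ∀ i ∈ s, v ∉ (a i).verts := by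
  classical
  rw [passCount, Finset.card_eq_zero, Finset.filter_eq_empty_iff]

open Classical in
lemma passCount_eq_sum (v : V) : passCount s a v = ∑ i ∈ s, if v ∈ (a i).verts then 1 else 0 := by
  rw [passCount, Finset.card_filter]

lemma passCount_eq_passCount_erase_add_one [DecidableEq ι] {k : ι} (hk : k ∈ s) {v : V}
    (hv : v ∈ (a k).verts) : passCount s a v = passCount (s.erase k) a v + 1 := by
  classical
  rw [passCount_eq_sum, passCount_eq_sum, ← Finset.add_sum_erase s _ hk, if_pos hv, add_comm]

open Classical in
/-- The children of a vertex. -/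
noncomputable def children (G : SimpleGraph V) [G.LocallyFinite] (r v : V) : Finset V :=
  (G.neighborFinset v).filter fun w => IsChild G r v w

lemma mem_children [G.LocallyFinite] {v w : V} : w ∈ children G r v ↔ IsChild G r v w := by
  classical
  rw [children, Finset.mem_filter, SimpleGraph.mem_neighborFinset]
  exact ⟨fun h => h.2, fun h => ⟨h.1, h⟩⟩

lemma sum_passCount_children [G.LocallyFinite] (hG : G.IsTree) {v : V} (hv : ¬ IsLeaf G r v) :
    ∑ w ∈ children G r v, passCount s a w = passCount s a v := by
  classical
  simp_rw [passCount_eq_sum]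
  rw [Finset.sum_comm]
  refine Finset.sum_congr rfl fun i _ => ?_
  by_cases h : v ∈ (a i).verts
  · obtain ⟨w, hw, hvw⟩ := ExtBoundary.exists_isChild_mem hG h hv
    rw [if_pos h, Finset.sum_eq_single_of_mem w (mem_children.2 hvw), if_pos hw]
    intro u hu hne
    exact if_neg fun hu' => hne (ExtBoundary.isChild_unique hG (mem_children.1 hu) hvw hu' hw)
  · rw [if_neg h]
    refine Finset.sum_eq_zero fun w hw => if_neg fun hw' => h ?_
    exact ExtBoundary.mem_verts_of_isChild hG (mem_children.1 hw) hw'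

open Classical in
lemma sum_pairing_eq_tsum (hG : G.IsTree) (ℓ : Sym2 V → ℝ) (σ : ExtBoundary G r) :
    ∑ i ∈ s, pairing ℓ σ (a i) =
      ∑' v, if v ∈ σ.verts then (passCount s a v : ℝ≥0∞) * edgeLength G r ℓ v else 0 := by
  simp_rw [pairing_eq_tsum hG]
  rw [← Summable.tsum_finsetSum fun _ _ => ENNReal.summable]
  refine tsum_congr fun v => ?_
  by_cases hv : v ∈ σ.verts
  · simp only [hv, true_and, if_true, passCount_eq_sum, Nat.cast_sum, Finset.sum_mul]
    refine Finset.sum_congr rfl fun i _ => ?_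
    split_ifs <;> simp
  · simp [hv]

lemma sum_pairing_le_sum_pairing (hG : G.IsTree) (ℓ : Sym2 V → ℝ) {κ : Type*} {t : Finset κ}
    {b : κ → ExtBoundary G r} {σ τ : ExtBoundary G r}
    (h : ∀ v ∈ σ.verts, passCount s a v ≠ 0 → v ∈ τ.verts ∧ passCount s a v ≤ passCount t b v) :
    ∑ i ∈ s, pairing ℓ σ (a i) ≤ ∑ i ∈ t, pairing ℓ τ (b i) := by
  rw [sum_pairing_eq_tsum hG, sum_pairing_eq_tsum hG]
  refine ENNReal.tsum_le_tsum fun v => ?_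
  by_cases hv : v ∈ σ.verts
  · by_cases h0 : passCount s a v = 0
    · simp [h0]
    · obtain ⟨h1, h2⟩ := h v hv h0
      rw [if_pos hv, if_pos h1]
      gcongr
  · simp [hv]

end passCount

/-! ### Comparing and minimizing sums of pairings -/

/-- If the family `b` is injective and larger than the family `a`, some member of `b` avoids `a`
and is at most as close to `a` as to the rest of `b`: descend from the root through vertices
that are passed more often by `b` than by `a`. -/
lemma exists_sum_pairing_le [G.LocallyFinite] (hG : G.IsTree) (ℓ : Sym2 V → ℝ) {ι κ : Type*}
    [DecidableEq κ] (s : Finset ι) (t : Finset κ) (a : ι → ExtBoundary G r)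
    (b : κ → ExtBoundary G r) (hb : Set.InjOn b t) (hst : s.card < t.card) :
    ∃ k ∈ t, (∀ i ∈ s, b k ≠ a i) ∧
      ∑ i ∈ s, pairing ℓ (b k) (a i) ≤ ∑ j ∈ t.erase k, pairing ℓ (b k) (b j) := by
  classical
  obtain ⟨σ, hσ⟩ := ExtBoundary.exists_forall_pt (r := r) hG
    (fun v => passCount s a v < passCount t b v)
    (by rwa [passCount_root hG, passCount_root hG]) (by
      intro v hv hl
      by_contra! hcon
      have : ∑ w ∈ children G r v, passCount t b w ≤ ∑ w ∈ children G r v, passCount s a w :=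
        Finset.sum_le_sum fun w hw => hcon w (mem_children.1 hw)
      rw [sum_passCount_children hG hl, sum_passCount_children hG hl] at this
      omega)
  obtain ⟨k, hk, rfl⟩ : ∃ k ∈ t, σ = b k := by
    by_contra! hcon
    obtain ⟨m, hm⟩ := ExtBoundary.exists_forall_pt_notMem hG t b hcon
    have := hσ m
    rw [passCount_eq_zero.2 hm] at this
    omega
  have hcount : ∀ v ∈ (b k).verts, passCount t b v = passCount (t.erase k) b v + 1 :=
    fun v hv => passCount_eq_passCount_erase_add_one hk hv
  refine ⟨k, hk, fun i hi hki => ?_, ?_⟩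
  · obtain ⟨m, hm⟩ := ExtBoundary.exists_forall_pt_notMem hG (t.erase k) b (σ := b k)
      (fun j hj h => (Finset.ne_of_mem_erase hj) (hb (Finset.mem_of_mem_erase hj) hk h.symm))
    have h1 := hσ m
    rw [hcount _ (ExtBoundary.pt_mem_verts _ m), passCount_eq_zero.2 hm] at h1
    have h2 : passCount s a ((b k).pt m) = 0 := by omega
    exact passCount_eq_zero.1 h2 i hi (hki ▸ ExtBoundary.pt_mem_verts _ m)
  · refine sum_pairing_le_sum_pairing hG ℓ fun v hv _ => ⟨hv, ?_⟩
    obtain ⟨m, rfl⟩ := hv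
    have h1 := hσ m
    rw [hcount _ (ExtBoundary.pt_mem_verts _ m)] at h1
    omega

/-- A minimizer of the sum of the pairings with a finite family exists outside the family: this
sum depends only on the vertex where a point leaves the union of the family, and it increases
along each member of the family. -/
lemma exists_minimizer (hG : G.IsTree) (ℓ : Sym2 V → ℝ) {ι : Type*} (s : Finset ι)
    (a : ι → ExtBoundary G r) (h : ∃ σ : ExtBoundary G r, ∀ i ∈ s, σ ≠ a i) :
    ∃ σ : ExtBoundary G r, (∀ i ∈ s, σ ≠ a i) ∧ ∀ τ : ExtBoundary G r, (∀ i ∈ s, τ ≠ a i) →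
      ∑ i ∈ s, pairing ℓ σ (a i) ≤ ∑ i ∈ s, pairing ℓ τ (a i) := by
  classical
  rcases s.eq_empty_or_nonempty with rfl | hs
  · obtain ⟨σ, -⟩ := h
    exact ⟨σ, by simp, by simp⟩
  -- `E i k σ`: the path `σ` leaves the union of the family at level `k`, at a vertex of `a i`.
  let E : ι → ℕ → ExtBoundary G r → Prop := fun i k σ =>
    σ.pt k ∈ (a i).verts ∧ ∀ j ∈ s, σ.pt (k + 1) ∉ (a j).verts
  have hexit : ∀ σ : ExtBoundary G r, (∀ i ∈ s, σ ≠ a i) → ∃ i ∈ s, ∃ k, E i k σ := by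
    intro σ hσ
    have hex := ExtBoundary.exists_forall_pt_notMem hG s a hσ
    obtain ⟨i₀, hi₀⟩ := hs
    have hpos : Nat.find hex ≠ 0 := by
      intro h0
      have h1 := Nat.find_spec hex i₀ hi₀
      rw [h0, (σ.isDescent_pt hG).1] at h1
      exact h1 (ExtBoundary.root_mem_verts hG _)
    obtain ⟨k, hk⟩ := Nat.exists_eq_succ_of_ne_zero hpos
    have h2 := Nat.find_min hex (m := k) (by omega)
    push Not at h2
    obtain ⟨i, hi, hik⟩ := h2
    refine ⟨i, hi, k, hik, ?_⟩
    rw [← Nat.succ_eq_add_one, ← hk]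
    exact Nat.find_spec hex
  have hdist : ∀ i ∈ s, ∀ k σ, E i k σ → G.dist r (σ.pt k) = k := by
    intro i hi k σ hE
    refine (σ.isDescent_pt hG).dist_of_not_isLeaf fun hl => hE.2 i hi ?_
    rw [(σ.isDescent_pt hG).eq_of_isLeaf hl (Nat.le_succ k)]
    exact hE.1
  -- Among the paths that leave the union along a given member, leaving early is better.
  have hcomp : ∀ i ∈ s, ∀ k k' σ τ, E i k σ → E i k' τ → k ≤ k' →
      ∑ i ∈ s, pairing ℓ σ (a i) ≤ ∑ i ∈ s, pairing ℓ τ (a i) := by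
    intro i hi k k' σ τ hσ hτ hk
    refine sum_pairing_le_sum_pairing hG ℓ fun v hv h0 => ⟨?_, le_rfl⟩
    rw [Ne, passCount_eq_zero] at h0
    push Not at h0
    obtain ⟨j, hj, hvj⟩ := h0
    have hvk : G.dist r v ≤ k := by
      by_contra! hlt
      refine ExtBoundary.pt_notMem_of_le hG (hσ.2 j hj) hlt ?_
      rwa [(ExtBoundary.mem_verts_iff hG).1 hv]
    have hvi : v ∈ (a i).verts := ExtBoundary.mem_verts_of_dist_le hG (σ.pt_mem_verts k) hσ.1 hv
      (by rwa [hdist i hi k σ hσ])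
    exact ExtBoundary.mem_verts_of_dist_le hG hτ.1 (τ.pt_mem_verts k') hvi
      (by rw [hdist i hi k' τ hτ]; omega)
  let s' := s.filter fun i => ∃ k σ, E i k σ
  have hmin : ∀ i, ∃ σ, i ∈ s' → (∃ k, E i k σ) ∧ ∀ k' τ, E i k' τ →
      ∑ i ∈ s, pairing ℓ σ (a i) ≤ ∑ i ∈ s, pairing ℓ τ (a i) := by
    intro i
    by_cases hi : i ∈ s'
    · obtain ⟨his, hex⟩ := Finset.mem_filter.1 hi
      obtain ⟨σ, hσ⟩ := Nat.find_spec hex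
      exact ⟨σ, fun _ => ⟨⟨_, hσ⟩, fun k' τ hτ =>
        hcomp i his _ _ σ τ hσ hτ (Nat.find_min' hex ⟨τ, hτ⟩)⟩⟩
    · obtain ⟨σ, -⟩ := h
      exact ⟨σ, fun h => absurd h hi⟩
  choose f hf using hmin
  have hs' : s'.Nonempty := by
    obtain ⟨σ, hσ⟩ := h
    obtain ⟨i, hi, k, hk⟩ := hexit σ hσ
    exact ⟨i, Finset.mem_filter.2 ⟨hi, k, σ, hk⟩⟩
  obtain ⟨i, hi, hle⟩ := Finset.exists_min_image s' (fun i => ∑ j ∈ s, pairing ℓ (f i) (a j)) hs'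
  refine ⟨f i, ?_, fun τ hτ => ?_⟩
  · obtain ⟨k, hk⟩ := (hf i hi).1
    intro j hj hij
    exact hk.2 j hj (hij ▸ ExtBoundary.pt_mem_verts _ _)
  · obtain ⟨j, hj, k, hk⟩ := hexit τ hτ
    have hj' : j ∈ s' := Finset.mem_filter.2 ⟨hj, k, τ, hk⟩
    exact (hle j hj').trans ((hf j hj').2 k τ hk)

/-! ### The factorials -/

lemma IsFactorialDefining.mono {ℓ : Sym2 V → ℝ} {ρ : ℕ → ExtBoundary G r} {m n : ℕ}
    (h : IsFactorialDefining ℓ ρ n) (hmn : m ≤ n) : IsFactorialDefining ℓ ρ m :=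
  fun k hk => h k (hk.trans hmn)

lemma IsFactorialDefining.injOn {ℓ : Sym2 V → ℝ} {ρ : ℕ → ExtBoundary G r} {n : ℕ}
    (h : IsFactorialDefining ℓ ρ n) : Set.InjOn ρ (Finset.range (n + 1)) := by
  intro i hi j hj hij
  rw [Finset.coe_range, Set.mem_Iio] at hi hj
  rcases lt_trichotomy i j with hlt | heq | hlt
  · exact absurd hij.symm ((h j (by omega)).1 i hlt)
  · exact heq
  · exact absurd hij ((h i (by omega)).1 j hlt)

/-- In a greedy sequence the last point has the largest sum of pairings with the other ones.
For a point `ρ k`, let `m` be the index of the last point before `ρ n` that is closer to `ρ k`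
than `ρ n` is. Up to the index `m` the claim holds by induction, and `ρ n` was a candidate for
`ρ m`; the points after `ρ m` are at least as close to `ρ n` as to `ρ k` by the ultrametric
inequality. -/
lemma IsFactorialDefining.sum_erase_le (hG : G.IsTree) {ℓ : Sym2 V → ℝ}
    {ρ : ℕ → ExtBoundary G r} {n : ℕ} (h : IsFactorialDefining ℓ ρ n) {k : ℕ} (hk : k ≤ n) :
    ∑ j ∈ (Finset.range (n + 1)).erase k, pairing ℓ (ρ k) (ρ j) ≤
      ∑ j ∈ Finset.range n, pairing ℓ (ρ n) (ρ j) := by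
  classical
  induction n using Nat.strong_induction_on generalizing k with
  | _ n ih =>
  rcases hk.eq_or_lt with rfl | hk
  · rw [Finset.range_add_one, Finset.erase_insert Finset.notMem_range_self]
  have hex := Finset.exists_max_image
    ((Finset.range n).filter fun j => j = k ∨ pairing ℓ (ρ k) (ρ n) < pairing ℓ (ρ k) (ρ j)) id
    ⟨k, by simp [hk]⟩
  obtain ⟨m, hm, hmax⟩ := hex
  simp only [Finset.mem_filter, Finset.mem_range, id] at hm hmax
  have hkm : k ≤ m := hmax k ⟨hk, Or.inl rfl⟩
  have hfar : ∀ j, m < j → j < n → pairing ℓ (ρ k) (ρ j) ≤ pairing ℓ (ρ k) (ρ n) := by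
    intro j hj hjn
    by_contra! hlt
    exact absurd (hmax j ⟨hjn, Or.inr hlt⟩) (by omega)
  have hfirst : ∑ j ∈ (Finset.range (m + 1)).erase k, pairing ℓ (ρ k) (ρ j) ≤
      ∑ j ∈ Finset.range m, pairing ℓ (ρ n) (ρ j) :=
    (ih m hm.1 (h.mono hm.1.le) hkm).trans
      ((h m hm.1.le).2 (ρ n) fun j hj => (h n le_rfl).1 j (by omega))
  have hmid : ∑ j ∈ Finset.Ico (m + 1) n, pairing ℓ (ρ k) (ρ j) ≤
      ∑ j ∈ Finset.Ico (m + 1) n, pairing ℓ (ρ n) (ρ j) := by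
    refine Finset.sum_le_sum fun j hj => ?_
    rw [Finset.mem_Ico] at hj
    have h1 := min_pairing_le hG ℓ (ρ n) (ρ k) (ρ j)
    rwa [pairing_comm ℓ (ρ n) (ρ k), min_eq_right (hfar j (by omega) (by omega))] at h1
  have hlast : pairing ℓ (ρ k) (ρ n) ≤ pairing ℓ (ρ n) (ρ m) := by
    rcases hm.2 with rfl | hlt
    · rw [pairing_comm]
    · have h1 := min_pairing_le hG ℓ (ρ m) (ρ k) (ρ n)
      rwa [pairing_comm ℓ (ρ m) (ρ k), min_eq_right hlt.le, pairing_comm ℓ (ρ m)] at h1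
  have hsplit : (Finset.range (n + 1)).erase k =
      ((Finset.range (m + 1)).erase k ∪ Finset.Ico (m + 1) n) ∪ {n} := by
    ext j
    simp only [Finset.mem_erase, Finset.mem_range, Finset.mem_union, Finset.mem_Ico,
      Finset.mem_singleton]
    omega
  have hd1 : Disjoint ((Finset.range (m + 1)).erase k) (Finset.Ico (m + 1) n) := by
    rw [Finset.disjoint_left]
    simp only [Finset.mem_erase, Finset.mem_range, Finset.mem_Ico]
    omega
  have hd2 : Disjoint ((Finset.range (m + 1)).erase k ∪ Finset.Ico (m + 1) n) {n} := by
    rw [Finset.disjoint_left]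
    simp only [Finset.mem_erase, Finset.mem_range, Finset.mem_Ico, Finset.mem_union,
      Finset.mem_singleton]
    omega
  rw [hsplit, Finset.sum_union hd2, Finset.sum_union hd1, Finset.sum_singleton,
    ← Finset.sum_range_add_sum_Ico _ (show m + 1 ≤ n from hm.1), Finset.sum_range_succ,
    add_right_comm _ (pairing ℓ (ρ n) (ρ m))]
  exact add_le_add (add_le_add hfirst hmid) hlast

/-- Among the points of a greedy sequence there is one outside a given family of `n` points whose
sum of pairings with the family is at most the last sum of the greedy procedure. -/
lemma IsFactorialDefining.exists_sum_le [G.LocallyFinite] (hG : G.IsTree) {ℓ : Sym2 V → ℝ}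
    {ρ : ℕ → ExtBoundary G r} {n : ℕ} (h : IsFactorialDefining ℓ ρ n) {ι : Type*} (s : Finset ι)
    (a : ι → ExtBoundary G r) (hs : s.card = n) :
    ∃ σ : ExtBoundary G r, (∀ i ∈ s, σ ≠ a i) ∧
      ∑ i ∈ s, pairing ℓ σ (a i) ≤ ∑ j ∈ Finset.range n, pairing ℓ (ρ n) (ρ j) := by
  obtain ⟨k, hk, hne, hle⟩ := exists_sum_pairing_le hG ℓ s (Finset.range (n + 1)) a ρ h.injOn
    (by rw [Finset.card_range]; omega)
  exact ⟨ρ k, hne, hle.trans (h.sum_erase_le hG (by simpa [Nat.lt_succ_iff] using hk))⟩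

lemma IsFactorialDefining.sum_le_sum [G.LocallyFinite] (hG : G.IsTree) {ℓ : Sym2 V → ℝ}
    {ρ τ : ℕ → ExtBoundary G r} {n : ℕ} (hρ : IsFactorialDefining ℓ ρ n)
    (hτ : IsFactorialDefining ℓ τ n) :
    ∑ j ∈ Finset.range n, pairing ℓ (ρ n) (ρ j) ≤
      ∑ j ∈ Finset.range n, pairing ℓ (τ n) (τ j) := by
  obtain ⟨σ, hne, hle⟩ := hτ.exists_sum_le hG (Finset.range n) ρ (Finset.card_range n)
  exact ((hρ n le_rfl).2 σ fun j hj => hne j (Finset.mem_range.2 hj)).trans hle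

/-- The value of the factorial does not depend on the choices made in the greedy procedure. -/
lemma IsFactorialDefining.sum_eq_factorial [G.LocallyFinite] (hG : G.IsTree) {ℓ : Sym2 V → ℝ}
    {ρ : ℕ → ExtBoundary G r} {n : ℕ} (h : IsFactorialDefining ℓ ρ n) :
    ∑ j ∈ Finset.range n, pairing ℓ (ρ n) (ρ j) = factorial G r ℓ n :=
  le_antisymm (le_iInf₂ fun _ hτ => h.sum_le_sum hG hτ) (iInf₂_le ρ h)

lemma exists_isFactorialDefining_of_factorial_ne_top {ℓ : Sym2 V → ℝ} {n : ℕ}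
    (h : factorial G r ℓ n ≠ ∞) : ∃ ρ : ℕ → ExtBoundary G r, IsFactorialDefining ℓ ρ n := by
  by_contra! hcon
  exact h (by rw [factorial]; simp [hcon])

/-- The factorials are superadditive: compare a greedy sequence of length `k + l + 1` with the
family that consists of its first `k` points and its first `l` points. -/
lemma factorial_add_le [G.LocallyFinite] (hG : G.IsTree) (ℓ : Sym2 V → ℝ) (k l : ℕ) :
    factorial G r ℓ k + factorial G r ℓ l ≤ factorial G r ℓ (k + l) := by
  by_cases hfin : factorial G r ℓ (k + l) = ∞
  · simp [hfin]
  obtain ⟨ρ, hρ⟩ := exists_isFactorialDefining_of_factorial_ne_top hfin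
  have hk := hρ.mono (Nat.le_add_right k l)
  have hl := hρ.mono (Nat.le_add_left l k)
  rw [← hρ.sum_eq_factorial hG, ← hk.sum_eq_factorial hG, ← hl.sum_eq_factorial hG]
  obtain ⟨σ, hne, hle⟩ := hρ.exists_sum_le hG
    ((Finset.range k).disjSum (Finset.range l)) (Sum.elim ρ ρ) (by simp)
  rw [Finset.sum_disjSum] at hle
  refine le_trans (add_le_add ?_ ?_) hle
  · exact (hk k le_rfl).2 σ fun j hj =>
      hne (.inl j) (Finset.inl_mem_disjSum.2 (Finset.mem_range.2 hj))
  · exact (hl l le_rfl).2 σ fun j hj =>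
      hne (.inr j) (Finset.inr_mem_disjSum.2 (Finset.mem_range.2 hj))

/-- Fekete's lemma for superadditive sequences in `[0, ∞]`. -/
lemma exists_tendsto_div_of_superadditive (f : ℕ → ℝ≥0∞) (hf : ∀ k l, f k + f l ≤ f (k + l)) :
    ∃ H : ℝ≥0∞, Tendsto (fun n : ℕ => f n / (n : ℝ≥0∞)) atTop (𝓝 H) ∧
      ∀ n : ℕ, n ≠ 0 → f n ≤ n * H := by
  have hmul : ∀ (q m : ℕ), (q : ℝ≥0∞) * f m ≤ f (q * m) := by
    intro q m
    induction q with
    | zero => simp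
    | succ q ih =>
      rw [Nat.cast_succ, add_mul, one_mul, Nat.succ_mul]
      exact (add_le_add ih le_rfl).trans (hf _ _)
  have hmono : ∀ m n, m ≤ n → f m ≤ f n := by
    intro m n hmn
    obtain ⟨d, rfl⟩ := Nat.exists_eq_add_of_le hmn
    exact le_self_add.trans (hf m d)
  refine ⟨⨆ (n : ℕ) (_ : n ≠ 0), f n / n, ?_, ?_⟩
  · refine tendsto_order.2 ⟨fun a ha => ?_, fun a ha => ?_⟩
    · simp only [lt_iSup_iff] at ha
      obtain ⟨m, hm, ha⟩ := ha
      obtain ⟨b, hab, hb⟩ := exists_between ha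
      lift a to NNReal using (hab.trans_le le_top).ne
      lift b to NNReal using (hb.trans_le le_top).ne
      have hab' : (a : ℝ) < b := by exact_mod_cast hab
      have hm0 : (m : ℝ≥0∞) ≠ 0 := by exact_mod_cast hm
      have hbm : (b : ℝ≥0∞) * m ≤ f m :=
        (ENNReal.le_div_iff_mul_le (Or.inl hm0) (Or.inl (ENNReal.natCast_ne_top m))).1 hb.le
      obtain ⟨N, hN⟩ := exists_nat_gt ((m : ℝ) * b / (b - a))
      filter_upwards [eventually_ge_atTop N, eventually_gt_atTop 0] with n hn hn0
      rw [ENNReal.lt_div_iff_mul_lt (Or.inl (by exact_mod_cast hn0.ne'))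
        (Or.inl (ENNReal.natCast_ne_top n))]
      have h1 : ((n / m : ℕ) : ℝ≥0∞) * ((b : ℝ≥0∞) * m) ≤ f n :=
        (mul_le_mul' le_rfl hbm).trans ((hmul _ _).trans (hmono _ _ (Nat.div_mul_le_self n m)))
      refine lt_of_lt_of_le ?_ h1
      have h2 : (n : ℝ) < ((n / m : ℕ) : ℝ) * m + m := by
        have h3 := Nat.lt_div_mul_add (a := n) (Nat.pos_of_ne_zero hm)
        exact_mod_cast h3
      have h4 : (m : ℝ) * b < n * (b - a) := by
        rw [div_lt_iff₀ (by linarith)] at hN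
        have : (N : ℝ) * (b - a) ≤ n * (b - a) :=
          mul_le_mul_of_nonneg_right (by exact_mod_cast hn) (by linarith)
        linarith
      have h5 : (a : ℝ) * n < ((n / m : ℕ) : ℝ) * (b * m) := by
        have hb0 : (0 : ℝ) < b := lt_of_le_of_lt a.2 hab'
        nlinarith
      exact_mod_cast h5
    · filter_upwards [eventually_gt_atTop 0] with n hn
      exact lt_of_le_of_lt (le_iSup₂_of_le n hn.ne' le_rfl) ha
  · intro n hn
    rw [mul_comm, ← ENNReal.div_le_iff_le_mul (Or.inl (by exact_mod_cast hn))
      (Or.inl (ENNReal.natCast_ne_top n))]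
    exact le_iSup₂_of_le n hn le_rfl

/-! ### Flows and the upper bound for the factorials -/

open Classical in
lemma ExtBoundary.tsum_verts (hG : G.IsTree) (σ : ExtBoundary G r) (F : V → ℝ≥0∞) :
    ∑' v, (if v ∈ σ.verts then F v else 0) =
      ∑' k, if G.dist r (σ.pt k) = k then F (σ.pt k) else 0 := by
  have hset : σ.verts = σ.pt '' {k | G.dist r (σ.pt k) = k} := by
    ext v
    constructor
    · intro hv
      have h := (mem_verts_iff hG).1 hv
      exact ⟨G.dist r v, by simp only [Set.mem_ofPred_eq, h], h⟩
    · rintro ⟨k, -, rfl⟩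
      exact ⟨k, rfl⟩
  have hinj : Set.InjOn σ.pt {k | G.dist r (σ.pt k) = k} := by
    intro k hk m hm h
    rw [Set.mem_ofPred_eq] at hk hm
    rw [← hk, ← hm, h]
  calc ∑' v, (if v ∈ σ.verts then F v else 0)
      = ∑' v : σ.verts, F v := by
        rw [tsum_subtype]
        exact tsum_congr fun v => by rw [Set.indicator_apply]
    _ = ∑' k : {k | G.dist r (σ.pt k) = k}, F (σ.pt k) := by
        rw [hset, tsum_image F hinj]
    _ = _ := by
        rw [tsum_subtype _ fun k => F (σ.pt k)]
        exact tsum_congr fun k => by rw [Set.indicator_apply]; rfl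

lemma passCount_eq_zero_of_isChild (hG : G.IsTree) {ι : Type*} {s : Finset ι}
    {a : ι → ExtBoundary G r} {u v : V} (h : IsChild G r u v) (hu : passCount s a u = 0) :
    passCount s a v = 0 := by
  rw [passCount_eq_zero] at hu ⊢
  exact fun i hi hv => hu i hi (ExtBoundary.mem_verts_of_isChild hG h hv)

lemma IsChild.edgeLength_eq (hG : G.IsTree) (ℓ : Sym2 V → ℝ) {u v : V} (h : IsChild G r u v) :
    edgeLength G r ℓ v = ENNReal.ofReal (ℓ s(u, v)) := by
  rw [edgeLength, if_neg h.ne_root, h.parent_eq hG]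

/-- If `σ` is an infinite path of finite length that belongs to the family, weak completeness
provides a point that branches off from `σ` far away, hence avoids the family, and that is not
closer to the family than `σ`. -/
lemma exists_branchOff (hG : G.IsTree) {ℓ : Sym2 V → ℝ} {ι : Type*} {s : Finset ι}
    {a : ι → ExtBoundary G r} (hwc : WeaklyComplete G r ℓ) {σ : ExtBoundary G r}
    (hσ : ∀ k, ¬ IsLeaf G r (σ.pt k)) (hmem : ∃ i ∈ s, σ = a i)
    (hfin : ∑ i ∈ s, pairing ℓ σ (a i) ≠ ∞) :
    ∃ τ : ExtBoundary G r, (∀ i ∈ s, τ ≠ a i) ∧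
      ∑ i ∈ s, pairing ℓ τ (a i) ≤ ∑ i ∈ s, pairing ℓ σ (a i) := by
  classical
  have hchild : ∀ k, IsChild G r (σ.pt k) (σ.pt (k + 1)) := fun k =>
    ((σ.isDescent_pt hG).2 k).resolve_right fun h1 => hσ k h1.1
  have hdist : ∀ k, G.dist r (σ.pt k) = k := fun k =>
    (σ.isDescent_pt hG).dist_of_not_isLeaf (hσ k)
  obtain ⟨K, hK⟩ := ExtBoundary.exists_forall_pt_notMem hG (s.filter fun i => σ ≠ a i) a
    (σ := σ) (fun i hi => (Finset.mem_filter.1 hi).2)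
  have hlen : ∑' k, ENNReal.ofReal (ℓ s(σ.pt (K + k), σ.pt (K + (k + 1)))) ≠ ∞ := by
    refine ne_top_of_le_ne_top hfin ?_
    rw [sum_pairing_eq_tsum hG, σ.tsum_verts hG]
    refine le_trans (ENNReal.tsum_le_tsum fun k => ?_)
      (ENNReal.tsum_comp_le_tsum_of_injective (f := fun k => K + (k + 1)) (fun k m h => by
        simpa using h) _)
    simp only [hdist, if_true]
    rw [← add_assoc, (hchild (K + k)).edgeLength_eq hG]
    refine le_mul_of_one_le_left zero_le ?_
    rw [Nat.one_le_cast, Nat.one_le_iff_ne_zero, Ne, passCount_eq_zero]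
    obtain ⟨i, hi, hia⟩ := hmem
    exact fun h1 => h1 i hi (hia ▸ ExtBoundary.pt_mem_verts _ _)
  have hbr : ∃ k, IsBranching G r (σ.pt (K + (k + 1))) := by
    by_contra! hcon
    exact hlen (hwc (σ.pt K) (fun k => σ.pt (K + k)) ⟨rfl, fun k => hchild (K + k)⟩ hcon)
  obtain ⟨k, hk⟩ := hbr
  obtain ⟨w, hw, hne⟩ := hk.exists_ne (σ.pt (K + (k + 1) + 1))
  have hw : IsChild G r (σ.pt (K + (k + 1))) w := hw
  have hwσ : w ∉ σ.verts := fun h1 =>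
    hne (ExtBoundary.isChild_unique hG hw (hchild _) h1 (σ.pt_mem_verts _))
  have hwa : ∀ i ∈ s, w ∉ (a i).verts := by
    intro i hi hwi
    have hiσ : σ ≠ a i := fun h1 => hwσ (h1 ▸ hwi)
    exact ExtBoundary.pt_notMem_of_le hG (hK i (Finset.mem_filter.2 ⟨hi, hiσ⟩))
      (Nat.le_add_right K (k + 1)) (ExtBoundary.mem_verts_of_isChild hG hw hwi)
  obtain ⟨τ, hτ⟩ := ExtBoundary.exists_mem_verts (r := r) hG w
  refine ⟨τ, fun i hi h1 => hwa i hi (h1 ▸ hτ), ?_⟩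
  refine sum_pairing_le_sum_pairing hG ℓ fun v hv h0 => ⟨?_, le_rfl⟩
  rw [Ne, passCount_eq_zero] at h0
  push Not at h0
  obtain ⟨i, hi, hvi⟩ := h0
  rcases le_or_gt (G.dist r v) (G.dist r (σ.pt (K + (k + 1)))) with hd | hd
  · exact ExtBoundary.mem_verts_of_dist_le hG (ExtBoundary.mem_verts_of_isChild hG hw hτ)
      (σ.pt_mem_verts _) hv hd
  · refine absurd (ExtBoundary.mem_verts_of_dist_le hG hv hvi hτ ?_) (hwa i hi)
    rw [hw.2]
    exact hd

lemma exists_isFactorialDefining (hG : G.IsTree) (ℓ : Sym2 V → ℝ)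
    (h : ∀ (n : ℕ) (a : ℕ → ExtBoundary G r), ∃ σ : ExtBoundary G r,
      ∀ i ∈ Finset.range n, σ ≠ a i) (n : ℕ) :
    ∃ ρ : ℕ → ExtBoundary G r, IsFactorialDefining ℓ ρ n := by
  have hstep : ∀ (m : ℕ) (ρ : ℕ → ExtBoundary G r), (∀ k < m, IsFactorialDefining ℓ ρ k) →
      ∃ ρ' : ℕ → ExtBoundary G r, IsFactorialDefining ℓ ρ' m := by
    intro m ρ hρ
    obtain ⟨σ, hσ, hmin⟩ := exists_minimizer hG ℓ (Finset.range m) ρ (h m ρ)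
    refine ⟨fun j => if j < m then ρ j else σ, fun k hk => ?_⟩
    have hρ' : ∀ j < k, (if j < m then ρ j else σ) = ρ j := fun j hj => if_pos (by omega)
    have hsum : ∀ τ, ∑ j ∈ Finset.range k, pairing ℓ τ (if j < m then ρ j else σ) =
        ∑ j ∈ Finset.range k, pairing ℓ τ (ρ j) := fun τ =>
      Finset.sum_congr rfl fun j hj => by rw [hρ' j (Finset.mem_range.1 hj)]
    simp only [hsum]
    rcases hk.lt_or_eq with hk | rfl
    · obtain ⟨h1, h2⟩ := hρ k hk k le_rfl
      simp only [if_pos hk]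
      exact ⟨fun j hj => by rw [hρ' j hj]; exact h1 j hj,
        fun τ hτ => h2 τ fun j hj => by rw [← hρ' j hj]; exact hτ j hj⟩
    · simp only [lt_irrefl, if_false]
      exact ⟨fun j hj => by rw [hρ' j hj]; exact hσ j (Finset.mem_range.2 hj),
        fun τ hτ => hmin τ fun j hj => by
          rw [← hρ' j (Finset.mem_range.1 hj)]; exact hτ j (Finset.mem_range.1 hj)⟩
  induction n with
  | zero =>
    obtain ⟨σ, -⟩ := h 0 fun _ => (ExtBoundary.exists_mem_verts (r := r) hG r).choose
    exact hstep 0 (fun _ => σ) (by simp)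
  | succ n ih =>
    obtain ⟨ρ, hρ⟩ := ih
    exact hstep (n + 1) ρ fun k hk => hρ.mono (Nat.lt_succ_iff.1 hk)

/-- The flow `θ` (where `θ v` is the amount that enters `v` from its parent) has the
potential `g`, which vanishes at the root and takes values in `[0, 1]`. The value `θ r` is the
strength of the flow, that is, the amount that leaves the root. The flow may be negative on some
edges. -/
structure IsPotentialFlow (G : SimpleGraph V) [G.LocallyFinite] (r : V) (ℓ : Sym2 V → ℝ)
    (g θ : V → ℝ) : Prop where
  root : g r = 0
  nonneg : ∀ v, 0 ≤ g v
  le_one : ∀ v, g v ≤ 1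
  conservation : ∀ v, ∑ w ∈ children G r v, θ w = θ v
  length_mul : ∀ u v, IsChild G r u v → ℓ s(u, v) * θ v = g v - g u

section

variable [G.LocallyFinite] {ℓ : Sym2 V → ℝ} {g θ : V → ℝ} {ι : Type*} {s : Finset ι}
  {a : ι → ExtBoundary G r}

lemma IsPotentialFlow.eq_zero_of_isLeaf (h : IsPotentialFlow G r ℓ g θ) {v : V}
    (hv : IsLeaf G r v) : θ v = 0 := by
  rw [← h.conservation v]
  exact Finset.sum_eq_zero fun w hw => absurd (mem_children.1 hw) (hv w)

/-- A family of points of the extended boundary induces a flow; if the flow `M * θ` is at least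
as strong, it dominates that flow along some point. -/
lemma IsPotentialFlow.exists_passCount_le (hG : G.IsTree) (h : IsPotentialFlow G r ℓ g θ) {M : ℝ}
    (hM : (s.card : ℝ) ≤ M * θ r) : ∃ σ : ExtBoundary G r, ∀ k,
      passCount s a (σ.pt k) = 0 ∨ (passCount s a (σ.pt k) : ℝ) ≤ M * θ (σ.pt k) := by
  refine ExtBoundary.exists_forall_pt hG
    (fun v => passCount s a v = 0 ∨ (passCount s a v : ℝ) ≤ M * θ v)
    (Or.inr (by rwa [passCount_root hG])) fun v hv hl => ?_
  rcases hv with hv | hv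
  · rw [IsLeaf] at hl
    push Not at hl
    obtain ⟨w, hw⟩ := hl
    exact ⟨w, hw, Or.inl (passCount_eq_zero_of_isChild hG hw hv)⟩
  · by_contra! hcon
    have hl' := hl
    rw [IsLeaf] at hl'
    push Not at hl'
    obtain ⟨w, hw⟩ := hl'
    have h1 : ∑ w ∈ children G r v, M * θ w < ∑ w ∈ children G r v, (passCount s a w : ℝ) :=
      Finset.sum_lt_sum_of_nonempty ⟨w, mem_children.2 hw⟩
        fun w hw => (hcon w (mem_children.1 hw)).2
    rw [← Finset.mul_sum, h.conservation, ← Nat.cast_sum, sum_passCount_children hG hl] at h1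
    linarith

open Classical in
lemma IsPotentialFlow.sum_pairing_le (hG : G.IsTree) (hℓ : ∀ e ∈ G.edgeSet, 0 < ℓ e)
    (h : IsPotentialFlow G r ℓ g θ) {M : ℝ} (hM : 0 ≤ M) {σ : ExtBoundary G r}
    (hσ : ∀ k, passCount s a (σ.pt k) = 0 ∨ (passCount s a (σ.pt k) : ℝ) ≤ M * θ (σ.pt k)) :
    ∑ i ∈ s, pairing ℓ σ (a i) ≤ ENNReal.ofReal M := by
  rw [sum_pairing_eq_tsum hG, σ.tsum_verts hG, ENNReal.tsum_eq_iSup_nat]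
  set F : ℕ → ℝ≥0∞ := fun k => if G.dist r (σ.pt k) = k then
    (passCount s a (σ.pt k) : ℝ≥0∞) * edgeLength G r ℓ (σ.pt k) else 0 with hF
  -- As long as the flow of the family is positive, its cost is at most `M * g`.
  have key : ∀ K, (passCount s a (σ.pt K) = 0 ∧
        ∑ k ∈ Finset.range (K + 1), F k ≤ ENNReal.ofReal M) ∨
      (passCount s a (σ.pt K) ≠ 0 ∧
        ∑ k ∈ Finset.range (K + 1), F k ≤ ENNReal.ofReal (M * g (σ.pt K))) := by
    have hle : ∀ v, M * g v ≤ M := fun v => mul_le_of_le_one_right hM (h.le_one v)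
    intro K
    induction K with
    | zero =>
      have h0 : ∑ k ∈ Finset.range (0 + 1), F k = 0 := by
        simp [hF, (σ.isDescent_pt hG).1, edgeLength]
      rw [h0]
      by_cases hc : passCount s a (σ.pt 0) = 0
      · exact Or.inl ⟨hc, zero_le⟩
      · exact Or.inr ⟨hc, zero_le⟩
    | succ K ih =>
      rw [Finset.sum_range_succ]
      rcases ih with ⟨hc, ih⟩ | ⟨hc, ih⟩
      · left
        have hc' : passCount s a (σ.pt (K + 1)) = 0 := by
          rcases (σ.isDescent_pt hG).2 K with h1 | h1
          · exact passCount_eq_zero_of_isChild hG h1 hc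
          · rw [h1.2, hc]
        refine ⟨hc', ?_⟩
        have : F (K + 1) = 0 := by simp [hF, hc']
        rwa [this, add_zero]
      · have hl : ¬ IsLeaf G r (σ.pt K) := by
          intro hl
          have h1 := (hσ K).resolve_left hc
          rw [h.eq_zero_of_isLeaf hl, mul_zero] at h1
          exact hc (by exact_mod_cast le_antisymm h1 (Nat.cast_nonneg _))
        have hch := ((σ.isDescent_pt hG).2 K).resolve_right fun h1 => hl h1.1
        by_cases hc' : passCount s a (σ.pt (K + 1)) = 0
        · left
          refine ⟨hc', ?_⟩
          have : F (K + 1) = 0 := by simp [hF, hc']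
          rw [this, add_zero]
          exact ih.trans (ENNReal.ofReal_le_ofReal (hle _))
        · right
          refine ⟨hc', ?_⟩
          have hpos : 0 < ℓ s(σ.pt K, σ.pt (K + 1)) := hℓ _ hch.1
          have hterm : (passCount s a (σ.pt (K + 1)) : ℝ) * ℓ s(σ.pt K, σ.pt (K + 1)) ≤
              M * (g (σ.pt (K + 1)) - g (σ.pt K)) := by
            rw [← h.length_mul _ _ hch]
            have := mul_le_mul_of_nonneg_right ((hσ (K + 1)).resolve_left hc') hpos.le
            linarith
          have hFK : F (K + 1) ≤ ENNReal.ofReal (M * (g (σ.pt (K + 1)) - g (σ.pt K))) := by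
            simp only [hF]
            split_ifs
            · rw [hch.edgeLength_eq hG, ← ENNReal.ofReal_natCast, ← ENNReal.ofReal_mul
                (Nat.cast_nonneg _)]
              exact ENNReal.ofReal_le_ofReal hterm
            · exact zero_le
          refine (add_le_add ih hFK).trans ?_
          rw [← ENNReal.ofReal_add (mul_nonneg hM (h.nonneg _))
            (le_trans (mul_nonneg (Nat.cast_nonneg _) hpos.le) hterm)]
          exact ENNReal.ofReal_le_ofReal (by linarith)
  refine iSup_le fun K => ?_
  refine (Finset.sum_le_sum_of_subset (Finset.range_subset_range.2 (Nat.le_succ K))).trans ?_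
  rcases key K with ⟨-, h1⟩ | ⟨-, h1⟩
  · exact h1
  · exact h1.trans (ENNReal.ofReal_le_ofReal (mul_le_of_le_one_right hM (h.le_one _)))

/-- A flow with bounded potential gives, outside each family of `n` points, a point whose sum of
pairings with the family is at most linear in `n`. -/
lemma IsPotentialFlow.exists_sum_pairing_le (hG : G.IsTree) (hℓ : ∀ e ∈ G.edgeSet, 0 < ℓ e)
    (hwc : WeaklyComplete G r ℓ) (h : IsPotentialFlow G r ℓ g θ) (hr : 0 < θ r)
    (s : Finset ι) (a : ι → ExtBoundary G r) :
    ∃ σ : ExtBoundary G r, (∀ i ∈ s, σ ≠ a i) ∧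
      ∑ i ∈ s, pairing ℓ σ (a i) ≤ ENNReal.ofReal (s.card / θ r) := by
  obtain ⟨σ, hσ⟩ := h.exists_passCount_le (s := s) (a := a) hG (M := s.card / θ r)
    (by rw [div_mul_cancel₀ _ hr.ne'])
  have hle := h.sum_pairing_le hG hℓ (div_nonneg (Nat.cast_nonneg _) hr.le) hσ
  by_cases hmem : ∃ i ∈ s, σ = a i
  · obtain ⟨τ, hτ, hτle⟩ := exists_branchOff hG hwc (fun k hl => by
      obtain ⟨i, hi, hia⟩ := hmem
      have h1 := hσ k
      rw [h.eq_zero_of_isLeaf hl, mul_zero, Nat.cast_nonpos, or_self, passCount_eq_zero] at h1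
      exact h1 i hi (hia ▸ ExtBoundary.pt_mem_verts _ _)) hmem
      (ne_top_of_le_ne_top ENNReal.ofReal_ne_top hle)
    exact ⟨τ, hτ, hτle.trans hle⟩
  · push Not at hmem
    exact ⟨σ, hmem, hle⟩

/-- A flow with bounded potential bounds the growth of the factorials. -/
lemma IsPotentialFlow.factorial_le (hG : G.IsTree) (hℓ : ∀ e ∈ G.edgeSet, 0 < ℓ e)
    (hwc : WeaklyComplete G r ℓ) (h : IsPotentialFlow G r ℓ g θ) (hr : 0 < θ r) (n : ℕ) :
    factorial G r ℓ n ≤ ENNReal.ofReal (n / θ r) := by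
  obtain ⟨ρ, hρ⟩ := exists_isFactorialDefining hG ℓ (fun n a =>
    (h.exists_sum_pairing_le hG hℓ hwc hr (Finset.range n) a).imp fun σ hσ => hσ.1) n
  obtain ⟨σ, hσ, hle⟩ := h.exists_sum_pairing_le hG hℓ hwc hr (Finset.range n) ρ
  rw [Finset.card_range] at hle
  rw [← hρ.sum_eq_factorial hG]
  exact ((hρ n le_rfl).2 σ fun j hj => hσ j (Finset.mem_range.2 hj)).trans hle

end

/-! ### Finite balls and sums over neighbours -/

lemma finite_dist_le [G.LocallyFinite] (hG : G.IsTree) (n : ℕ) :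
    {v | G.dist r v ≤ n}.Finite := by
  induction n with
  | zero =>
    refine (Set.finite_singleton r).subset fun v hv => ?_
    exact (dist_eq_zero hG).1 (Nat.le_zero.1 hv)
  | succ n ih =>
    refine ((ih.biUnion fun v _ => (children G r v).finite_toSet).union
      (Set.finite_singleton r)).subset fun v hv => ?_
    by_cases h : v = r
    · exact Or.inr h
    · have hv' : G.dist r v ≤ n + 1 := hv
      have hc := isChild_parent hG h
      refine Or.inl (Set.mem_biUnion (x := parent G r v) ?_ (mem_children.2 hc))
      have := hc.2
      exact Set.mem_ofPred_eq.mpr (show G.dist r (parent G r v) ≤ n by omega)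

lemma countable_of_isTree [G.LocallyFinite] (hG : G.IsTree) (r : V) : Countable V := by
  rw [← Set.countable_univ_iff]
  refine (Set.countable_iUnion fun n => (finite_dist_le (r := r) hG n).countable).mono
    fun v _ => Set.mem_iUnion.2 ⟨G.dist r v, ?_⟩
  exact le_refl (G.dist r v)

lemma sum_neighborFinset_root [G.LocallyFinite] (hG : G.IsTree) (f : V → ℝ) :
    ∑ w ∈ G.neighborFinset r, f w = ∑ w ∈ children G r r, f w := by
  congr 1
  ext w
  rw [mem_children, SimpleGraph.mem_neighborFinset]
  refine ⟨fun h => (isChild_or_isChild_of_adj hG h).resolve_right fun h' => ?_, fun h => h.1⟩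
  exact h'.ne_root rfl

lemma sum_neighborFinset_of_ne [G.LocallyFinite] (hG : G.IsTree) {v : V} (hv : v ≠ r)
    (f : V → ℝ) : ∑ w ∈ G.neighborFinset v, f w =
      ∑ w ∈ children G r v, f w + f (parent G r v) := by
  classical
  have hc := isChild_parent hG hv
  have hset : G.neighborFinset v = insert (parent G r v) (children G r v) := by
    ext w
    rw [Finset.mem_insert, mem_children, SimpleGraph.mem_neighborFinset]
    constructor
    · intro h
      rcases isChild_or_isChild_of_adj (r := r) hG h with h | h
      · exact Or.inr h
      · exact Or.inl (h.parent_eq hG).symm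
    · rintro (rfl | h)
      · exact hc.1.symm
      · exact h.1
  have hnot : parent G r v ∉ children G r v := by
    intro h
    have h1 := (mem_children.1 h).2
    have h2 := hc.2
    omega
  rw [hset, Finset.sum_insert hnot, add_comm]

/-! ### Energy -/

section

variable {ℓ : Sym2 V → ℝ} {N : ℕ} {F : Finset V} {φ : V → ℝ}

/-- Discrete Green formula for a function with finite support. -/
lemma sum_sq_div_length [G.LocallyFinite] (hG : G.IsTree) (hF : ∀ v, v ∈ F ↔ G.dist r v ≤ N)
    (hφ : ∀ v, N ≤ G.dist r v → φ v = 0) [DecidableEq V] :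
    ∑ v ∈ F.erase r, (ℓ s(parent G r v, v))⁻¹ * (φ (parent G r v) - φ v) ^ 2 =
      ∑ u ∈ F, φ u * ∑ w ∈ G.neighborFinset u, (ℓ s(u, w))⁻¹ * (φ u - φ w) := by
  classical
  have hr : r ∈ F := (hF r).2 (by simp)
  let h : V → V → ℝ := fun u w => φ u * ((ℓ s(u, w))⁻¹ * (φ u - φ w))
  have hchildren : ∑ u ∈ F, ∑ w ∈ children G r u, h u w =
      ∑ w ∈ F.erase r, h (parent G r w) w := by
    have h1 : ∀ u ∈ F, ∑ w ∈ children G r u, h u w =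
        ∑ w ∈ F, if IsChild G r u w then h u w else 0 := by
      intro u hu
      rw [← Finset.sum_filter]
      symm
      refine Finset.sum_subset (fun w hw => mem_children.2 (Finset.mem_filter.1 hw).2) ?_
      intro w hw hwn
      have hw' := mem_children.1 hw
      have : φ u = 0 := by
        apply hφ
        by_contra! hlt
        exact hwn (Finset.mem_filter.2 ⟨(hF w).2 (by rw [hw'.2]; omega), hw'⟩)
      simp [h, this]
    rw [Finset.sum_congr rfl h1, Finset.sum_comm, ← Finset.add_sum_erase F _ hr]
    have h2 : ∑ u ∈ F, (if IsChild G r u r then h u r else 0) = 0 :=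
      Finset.sum_eq_zero fun u _ => if_neg fun h' => h'.ne_root rfl
    rw [h2, zero_add]
    refine Finset.sum_congr rfl fun w hw => ?_
    obtain ⟨hwr, hwF⟩ := Finset.mem_erase.1 hw
    have hc := isChild_parent hG hwr
    have hpF : parent G r w ∈ F := by
      have h3 := (hF w).1 hwF
      have := hc.2
      exact (hF _).2 (by omega)
    rw [Finset.sum_eq_single_of_mem _ hpF, if_pos hc]
    intro u _ hne
    exact if_neg fun h' => hne (h'.parent_unique hG hc)
  have hsplit : ∑ u ∈ F, φ u * ∑ w ∈ G.neighborFinset u, (ℓ s(u, w))⁻¹ * (φ u - φ w) =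
      ∑ u ∈ F, ∑ w ∈ children G r u, h u w + ∑ u ∈ F.erase r, h u (parent G r u) := by
    rw [← Finset.add_sum_erase F _ hr, ← Finset.add_sum_erase F (fun u => ∑ w ∈ children G r u, _)
      hr, add_assoc, ← Finset.sum_add_distrib]
    congr 1
    · rw [sum_neighborFinset_root hG, Finset.mul_sum]
    · refine Finset.sum_congr rfl fun u hu => ?_
      rw [sum_neighborFinset_of_ne hG (Finset.ne_of_mem_erase hu), mul_add, Finset.mul_sum]
  rw [hsplit, hchildren, ← Finset.sum_add_distrib]
  refine Finset.sum_congr rfl fun w _ => ?_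
  simp only [h]
  rw [Sym2.eq_swap (a := w)]
  ring

open Classical in
/-- The increments of a function along a point of the extended boundary telescope. -/
lemma sum_sub_along [DecidableEq V] (hG : G.IsTree) (hF : ∀ v, v ∈ F ↔ G.dist r v ≤ N) (φ : V → ℝ)
    (ρ : ExtBoundary G r) :
    ∑ v ∈ F.erase r, (if v ∈ ρ.verts then φ (parent G r v) - φ v else 0) =
      φ r - φ (ρ.pt N) := by
  have key : ∀ m ≤ N, ∑ v ∈ (F.erase r).filter (fun v => v ∈ ρ.verts ∧ G.dist r v ≤ m),
      (φ (parent G r v) - φ v) = φ r - φ (ρ.pt m) := by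
    intro m hm
    induction m with
    | zero =>
      rw [(ρ.isDescent_pt hG).1, sub_self]
      refine Finset.sum_eq_zero fun v hv => ?_
      rw [Finset.mem_filter, Finset.mem_erase, Nat.le_zero, dist_eq_zero hG] at hv
      exact absurd hv.2.2 hv.1.1
    | succ m ih =>
      have ih := ih (by omega)
      rcases (ρ.isDescent_pt hG).2 m with h | h
      · have hd : G.dist r (ρ.pt m) = m :=
          (ρ.isDescent_pt hG).dist_of_not_isLeaf fun hl => hl _ h
        have hd' : G.dist r (ρ.pt (m + 1)) = m + 1 := by rw [h.2, hd]
        have hset : (F.erase r).filter (fun v => v ∈ ρ.verts ∧ G.dist r v ≤ m + 1) =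
            insert (ρ.pt (m + 1)) ((F.erase r).filter
              (fun v => v ∈ ρ.verts ∧ G.dist r v ≤ m)) := by
          ext v
          simp only [Finset.mem_filter, Finset.mem_erase, Finset.mem_insert, hF]
          constructor
          · rintro ⟨⟨h1, h2⟩, h3, h4⟩
            rcases h4.eq_or_lt with h5 | h5
            · left
              rw [← (ExtBoundary.mem_verts_iff hG).1 h3, h5]
            · exact Or.inr ⟨⟨h1, h2⟩, h3, by omega⟩
          · rintro (rfl | ⟨⟨h1, h2⟩, h3, h4⟩)
            · exact ⟨⟨h.ne_root, by omega⟩, ρ.pt_mem_verts _, hd'.le⟩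
            · exact ⟨⟨h1, h2⟩, h3, by omega⟩
        have hnot : ρ.pt (m + 1) ∉ (F.erase r).filter
            (fun v => v ∈ ρ.verts ∧ G.dist r v ≤ m) := by
          simp only [Finset.mem_filter, not_and, not_le]
          intro _ _
          omega
        rw [hset, Finset.sum_insert hnot, ih, h.parent_eq hG]
        ring
      · rw [h.2, ← ih]
        refine Finset.sum_congr (Finset.filter_congr fun v _ => ?_) fun _ _ => rfl
        refine and_congr_right fun hv => ⟨fun h1 => ?_, fun h1 => by omega⟩
        by_contra! h2
        have h3 := (ExtBoundary.mem_verts_iff hG).1 hv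
        rw [show G.dist r v = m + 1 by omega, h.2] at h3
        have h4 := (ρ.isDescent_pt hG).dist_le m
        rw [h3] at h4
        omega
  rw [← key N le_rfl, ← Finset.sum_filter]
  refine Finset.sum_congr (Finset.filter_congr fun v hv => ?_) fun _ _ => rfl
  exact (and_iff_left ((hF v).1 (Finset.mem_of_mem_erase hv))).symm

lemma sum_apply_pt_le (hG : G.IsTree) (hF : ∀ v, v ∈ F ↔ G.dist r v ≤ N)
    (hφ0 : ∀ v, 0 ≤ φ v) (hφ : ∀ v, N ≤ G.dist r v → φ v = 0) {n : ℕ} {ρ : ℕ → ExtBoundary G r}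
    (hρ : Set.InjOn ρ (Finset.range n)) :
    ∑ k ∈ Finset.range n, φ ((ρ k).pt N) ≤ ∑ v ∈ F, φ v := by
  classical
  have hinj : Set.InjOn (fun k => (ρ k).pt N)
      ((Finset.range n).filter fun k => φ ((ρ k).pt N) ≠ 0) := by
    intro i hi j hj hij
    rw [Finset.mem_coe, Finset.mem_filter] at hi hj
    refine hρ hi.1 hj.1 ?_
    rcases ((ρ i).isDescent_pt hG).dist_eq_or N with h | h
    · exact absurd (hφ _ h.ge) hi.2
    · refine ExtBoundary.eq_of_isLeaf_mem hG h.1 ((ρ i).pt_mem_verts N) ?_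
      exact ⟨N, hij.symm⟩
  rw [← Finset.sum_filter_ne_zero, ← Finset.sum_image (f := φ) hinj]
  refine Finset.sum_le_sum_of_subset_of_nonneg ?_ fun v _ _ => hφ0 v
  intro v hv
  obtain ⟨k, -, rfl⟩ := Finset.mem_image.1 hv
  exact (hF _).2 (((ρ k).isDescent_pt hG).dist_le N)

/-- The flow of a greedy sequence has small energy, apart from the self-energies. -/
lemma IsFactorialDefining.sum_length_mul_le (hG : G.IsTree) (hℓ : ∀ e ∈ G.edgeSet, 0 < ℓ e)
    {n : ℕ} {ρ : ℕ → ExtBoundary G r} (hρ : IsFactorialDefining ℓ ρ n) {C : ℝ} (hC : 0 ≤ C)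
    (hle : ∑ j ∈ Finset.range n, pairing ℓ (ρ n) (ρ j) ≤ ENNReal.ofReal C) [DecidableEq V]
    (F : Finset V) :
    ∑ v ∈ F.erase r, ℓ s(parent G r v, v) *
      (passCount (Finset.range (n + 1)) ρ v * (passCount (Finset.range (n + 1)) ρ v - 1)) ≤
      (n + 1) * C := by
  classical
  have hpos : ∀ v ∈ F.erase r, 0 < ℓ s(parent G r v, v) := fun v hv =>
    hℓ _ (isChild_parent hG (Finset.ne_of_mem_erase hv)).1
  have hone : ∀ k ∈ Finset.range (n + 1), ∑ v ∈ F.erase r, (if v ∈ (ρ k).verts then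
      ℓ s(parent G r v, v) * ((passCount (Finset.range (n + 1)) ρ v : ℝ) - 1) else 0) ≤ C := by
    intro k hk
    have h1 := (hρ.sum_erase_le hG (k := k) (by simpa [Nat.lt_succ_iff] using hk)).trans hle
    rw [sum_pairing_eq_tsum hG] at h1
    have h2 := (ENNReal.sum_le_tsum (F.erase r)).trans h1
    rw [← ENNReal.ofReal_le_ofReal_iff hC]
    refine le_of_eq_of_le ?_ h2
    rw [ENNReal.ofReal_sum_of_nonneg]
    · refine Finset.sum_congr rfl fun v hv => ?_
      by_cases hvk : v ∈ (ρ k).verts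
      · rw [if_pos hvk, if_pos hvk, passCount_eq_passCount_erase_add_one hk hvk, Nat.cast_add_one,
          add_sub_cancel_right, edgeLength, if_neg (Finset.ne_of_mem_erase hv), mul_comm,
          ENNReal.ofReal_mul (Nat.cast_nonneg _), ENNReal.ofReal_natCast]
      · rw [if_neg hvk, if_neg hvk, ENNReal.ofReal_zero]
    · intro v hv
      split_ifs with hvk
      · rw [passCount_eq_passCount_erase_add_one hk hvk, Nat.cast_add_one, add_sub_cancel_right]
        exact mul_nonneg (hpos v hv).le (Nat.cast_nonneg _)
      · exact le_rfl
  calc _ = ∑ k ∈ Finset.range (n + 1), ∑ v ∈ F.erase r, (if v ∈ (ρ k).verts then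
      ℓ s(parent G r v, v) * ((passCount (Finset.range (n + 1)) ρ v : ℝ) - 1) else 0) := by
        rw [Finset.sum_comm]
        refine Finset.sum_congr rfl fun v _ => ?_
        rw [← Finset.sum_filter, Finset.sum_const, nsmul_eq_mul]
        change _ = (passCount (Finset.range (n + 1)) ρ v : ℝ) * _
        ring
    _ ≤ ∑ k ∈ Finset.range (n + 1), C := Finset.sum_le_sum hone
    _ = (n + 1) * C := by simp

/-- Linear growth of the factorials bounds the value at the root of a finitely supported
function by its Dirichlet energy (the effective resistance is at most `h`). The flows along greedy
sequences of growing length take the role of the unit flow in Thomson's principle. -/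
lemma sq_apply_root_le [G.LocallyFinite] (hG : G.IsTree) (hℓ : ∀ e ∈ G.edgeSet, 0 < ℓ e)
    {h : ℝ} (h0 : 0 ≤ h)
    (hfac : ∀ n : ℕ, n ≠ 0 → factorial G r ℓ n ≤ ENNReal.ofReal (n * h))
    (hF : ∀ v, v ∈ F ↔ G.dist r v ≤ N) (hφ0 : ∀ v, 0 ≤ φ v)
    (hφ : ∀ v, N ≤ G.dist r v → φ v = 0) [DecidableEq V] :
    φ r ^ 2 ≤
      h * ∑ v ∈ F.erase r, (ℓ s(parent G r v, v))⁻¹ * (φ (parent G r v) - φ v) ^ 2 := by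
  classical
  set D := ∑ v ∈ F.erase r, (ℓ s(parent G r v, v))⁻¹ * (φ (parent G r v) - φ v) ^ 2 with hD
  set Λ := ∑ v ∈ F.erase r, ℓ s(parent G r v, v) with hΛ
  set K := ∑ v ∈ F, φ v with hK
  have hpos : ∀ v ∈ F.erase r, 0 < ℓ s(parent G r v, v) := fun v hv =>
    hℓ _ (isChild_parent hG (Finset.ne_of_mem_erase hv)).1
  have hD0 : 0 ≤ D := Finset.sum_nonneg fun v hv =>
    mul_nonneg (inv_nonneg.2 (hpos v hv).le) (sq_nonneg _)
  -- The estimate given by a greedy sequence of `n + 1` points, divided by `n + 1`. The constant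
  -- `K` bounds the contribution of the points that are leaves in `F`, where `φ` need not vanish,
  -- and `Λ` that of the self-energies.
  have hmain : ∀ n : ℕ, n ≠ 0 →
      ((n : ℝ) + 1) * (φ r ^ 2 - h * D) ≤ Λ * D + 2 * φ r * K := by
    intro n hn
    obtain ⟨ρ, hρ⟩ := exists_isFactorialDefining_of_factorial_ne_top
      (ne_top_of_le_ne_top ENNReal.ofReal_ne_top (hfac n hn))
    have hle := hfac n hn
    rw [← hρ.sum_eq_factorial hG] at hle
    have henergy := hρ.sum_length_mul_le hG hℓ (mul_nonneg (Nat.cast_nonneg n) h0) hle F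
    set c : V → ℝ := fun v => passCount (Finset.range (n + 1)) ρ v with hc
    have hc1 : ∀ v, c v ≤ n + 1 := by
      intro v
      have : passCount (Finset.range (n + 1)) ρ v ≤ n + 1 :=
        (Finset.card_filter_le _ _).trans (Finset.card_range _).le
      simp only [hc]
      exact_mod_cast this
    set κ := ∑ k ∈ Finset.range (n + 1), φ ((ρ k).pt N) with hκ
    have hκK : κ ≤ K := sum_apply_pt_le hG hF hφ0 hφ hρ.injOn
    have htel : ((n : ℝ) + 1) * φ r - κ =
        ∑ v ∈ F.erase r, c v * (φ (parent G r v) - φ v) := by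
      calc ((n : ℝ) + 1) * φ r - κ
          = ∑ k ∈ Finset.range (n + 1), (φ r - φ ((ρ k).pt N)) := by
            rw [Finset.sum_sub_distrib]; simp [hκ]
        _ = ∑ k ∈ Finset.range (n + 1), ∑ v ∈ F.erase r,
              (if v ∈ (ρ k).verts then φ (parent G r v) - φ v else 0) :=
            Finset.sum_congr rfl fun k _ => (sum_sub_along hG hF φ (ρ k)).symm
        _ = _ := by
            rw [Finset.sum_comm]
            refine Finset.sum_congr rfl fun v _ => ?_
            rw [← Finset.sum_filter, Finset.sum_const, nsmul_eq_mul]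
            rfl
    have hcs : (((n : ℝ) + 1) * φ r - κ) ^ 2 ≤
        (∑ v ∈ F.erase r, ℓ s(parent G r v, v) * c v ^ 2) * D := by
      rw [htel]
      refine Finset.sum_sq_le_sum_mul_sum_of_sq_le_mul _
        (fun v hv => mul_nonneg (hpos v hv).le (sq_nonneg _))
        (fun v hv => mul_nonneg (inv_nonneg.2 (hpos v hv).le) (sq_nonneg _)) fun v hv => ?_
      have := (hpos v hv).ne'
      refine le_of_eq ?_
      field_simp
    have hsq : ∑ v ∈ F.erase r, ℓ s(parent G r v, v) * c v ^ 2 ≤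
        (n + 1) * (n * h) + (n + 1) * Λ := by
      have h1 : ∑ v ∈ F.erase r, ℓ s(parent G r v, v) * c v ≤ (n + 1) * Λ := by
        rw [hΛ, Finset.mul_sum]
        refine Finset.sum_le_sum fun v hv => ?_
        rw [mul_comm]
        exact mul_le_mul_of_nonneg_right (hc1 v) (hpos v hv).le
      calc ∑ v ∈ F.erase r, ℓ s(parent G r v, v) * c v ^ 2
          = ∑ v ∈ F.erase r, ℓ s(parent G r v, v) * (c v * (c v - 1)) +
            ∑ v ∈ F.erase r, ℓ s(parent G r v, v) * c v := by
            rw [← Finset.sum_add_distrib]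
            exact Finset.sum_congr rfl fun v _ => by ring
        _ ≤ _ := add_le_add henergy h1
    have hx := hφ0 r
    have hn1 : (0 : ℝ) < n + 1 := by positivity
    have h2 := hcs.trans (mul_le_mul_of_nonneg_right hsq hD0)
    have h3 : ((n : ℝ) + 1) * φ r * κ ≤ ((n : ℝ) + 1) * φ r * K :=
      mul_le_mul_of_nonneg_left hκK (mul_nonneg hn1.le hx)
    have h4 : 0 ≤ h * D := mul_nonneg h0 hD0
    refine le_of_mul_le_mul_left ?_ hn1
    nlinarith [sq_nonneg κ]
  by_contra! hlt
  obtain ⟨n, hn⟩ := exists_nat_gt ((Λ * D + 2 * φ r * K) / (φ r ^ 2 - h * D))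
  rw [div_lt_iff₀ (by linarith)] at hn
  have h1 := hmain (n + 1) (Nat.succ_ne_zero n)
  push_cast at h1
  nlinarith

end

/-! ### The averaging operator of the random walk -/

section average

variable [G.LocallyFinite] {ℓ : Sym2 V → ℝ}

/-- The total conductance of the edges at a vertex. -/
noncomputable def totalConductance (G : SimpleGraph V) [G.LocallyFinite] (ℓ : Sym2 V → ℝ) (v : V) :
    ℝ :=
  ∑ w ∈ G.neighborFinset v, (ℓ s(v, w))⁻¹

/-- The expectation of `f` after one step of the random walk from `v`. -/
noncomputable def stepAverage (G : SimpleGraph V) [G.LocallyFinite] (ℓ : Sym2 V → ℝ) (f : V → ℝ)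
    (v : V) : ℝ :=
  (∑ w ∈ G.neighborFinset v, (ℓ s(v, w))⁻¹ * f w) / totalConductance G ℓ v

lemma inv_length_pos (hℓ : ∀ e ∈ G.edgeSet, 0 < ℓ e) {v w : V} (hw : w ∈ G.neighborFinset v) :
    0 < (ℓ s(v, w))⁻¹ :=
  inv_pos.2 (hℓ _ ((SimpleGraph.mem_neighborFinset _ _ _).1 hw))

lemma totalConductance_pos [Nontrivial V] (hG : G.IsTree) (hℓ : ∀ e ∈ G.edgeSet, 0 < ℓ e) (v : V) :
    0 < totalConductance G ℓ v := by
  obtain ⟨w, hw⟩ := hG.connected.preconnected.exists_adj_of_nontrivial v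
  exact Finset.sum_pos (fun w hw => inv_length_pos hℓ hw)
    ⟨w, (SimpleGraph.mem_neighborFinset _ _ _).2 hw⟩

lemma totalConductance_nonneg (hℓ : ∀ e ∈ G.edgeSet, 0 < ℓ e) (v : V) :
    0 ≤ totalConductance G ℓ v :=
  Finset.sum_nonneg fun _ hw => (inv_length_pos hℓ hw).le

lemma stepAverage_mono (hℓ : ∀ e ∈ G.edgeSet, 0 < ℓ e) {f g : V → ℝ} (h : ∀ v, f v ≤ g v) (v : V) :
    stepAverage G ℓ f v ≤ stepAverage G ℓ g v :=
  div_le_div_of_nonneg_right (Finset.sum_le_sum fun w hw =>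
    mul_le_mul_of_nonneg_left (h w) (inv_length_pos hℓ hw).le) (totalConductance_nonneg hℓ v)

lemma stepAverage_nonneg (hℓ : ∀ e ∈ G.edgeSet, 0 < ℓ e) {f : V → ℝ} (h : ∀ v, 0 ≤ f v) (v : V) :
    0 ≤ stepAverage G ℓ f v :=
  div_nonneg (Finset.sum_nonneg fun w hw => mul_nonneg (inv_length_pos hℓ hw).le (h w))
    (totalConductance_nonneg hℓ v)

lemma stepAverage_one [Nontrivial V] (hG : G.IsTree) (hℓ : ∀ e ∈ G.edgeSet, 0 < ℓ e) (v : V) :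
    stepAverage G ℓ (fun _ => 1) v = 1 := by
  simp only [stepAverage, mul_one]
  exact div_self (totalConductance_pos hG hℓ v).ne'

lemma sum_sub_eq_totalConductance_mul [Nontrivial V] (hG : G.IsTree)
    (hℓ : ∀ e ∈ G.edgeSet, 0 < ℓ e) (f : V → ℝ) (v : V) :
    ∑ w ∈ G.neighborFinset v, (ℓ s(v, w))⁻¹ * (f v - f w) =
      totalConductance G ℓ v * (f v - stepAverage G ℓ f v) := by
  rw [mul_sub, stepAverage, mul_div_cancel₀ _ (totalConductance_pos hG hℓ v).ne',
    totalConductance, Finset.sum_mul, ← Finset.sum_sub_distrib]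
  exact Finset.sum_congr rfl fun w _ => mul_sub _ _ _

lemma tendsto_stepAverage {f : ℕ → V → ℝ} {g : V → ℝ}
    (h : ∀ v, Tendsto (fun n => f n v) atTop (𝓝 (g v))) (v : V) :
    Tendsto (fun n => stepAverage G ℓ (f n) v) atTop (𝓝 (stepAverage G ℓ g v)) :=
  (tendsto_finsetSum _ fun w _ => (h w).const_mul _).div_const _

open Classical in
/-- The probability that the random walk from `v` is at `r` at time `n`. -/
noncomputable def returnProb (G : SimpleGraph V) [G.LocallyFinite] (r : V) (ℓ : Sym2 V → ℝ) :
    ℕ → V → ℝ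
  | 0 => fun v => if v = r then 1 else 0
  | n + 1 => stepAverage G ℓ (returnProb G r ℓ n)

open Classical in
/-- The probability that the random walk from `v` is not at `r` at the times `0, …, n`. -/
noncomputable def avoidProb (G : SimpleGraph V) [G.LocallyFinite] (r : V) (ℓ : Sym2 V → ℝ) :
    ℕ → V → ℝ
  | 0 => fun v => if v = r then 0 else 1
  | n + 1 => fun v => if v = r then 0 else stepAverage G ℓ (avoidProb G r ℓ n) v

open Classical in
lemma returnProb_zero (v : V) : returnProb G r ℓ 0 v = if v = r then 1 else 0 := rfl

open Classical in
lemma avoidProb_zero (v : V) : avoidProb G r ℓ 0 v = if v = r then 0 else 1 := rfl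

open Classical in
lemma avoidProb_succ (n : ℕ) (v : V) : avoidProb G r ℓ (n + 1) v =
    if v = r then 0 else stepAverage G ℓ (avoidProb G r ℓ n) v := rfl

lemma returnProb_nonneg (hℓ : ∀ e ∈ G.edgeSet, 0 < ℓ e) (n : ℕ) :
    ∀ v, 0 ≤ returnProb G r ℓ n v := by
  induction n with
  | zero => intro v; rw [returnProb_zero]; split_ifs <;> norm_num
  | succ n ih => exact stepAverage_nonneg hℓ ih

lemma returnProb_eq_zero (hG : G.IsTree) (n : ℕ) :
    ∀ v, n < G.dist r v → returnProb G r ℓ n v = 0 := by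
  induction n with
  | zero =>
    intro v hv
    rw [returnProb_zero, if_neg]
    rintro rfl
    simp at hv
  | succ n ih =>
    intro v hv
    rw [returnProb, stepAverage, Finset.sum_eq_zero, zero_div]
    intro w hw
    rw [ih w, mul_zero]
    rcases hG.dist_eq_dist_add_one_of_adj r ((SimpleGraph.mem_neighborFinset _ _ _).1 hw) with
      h | h <;> omega

lemma avoidProb_root (n : ℕ) : avoidProb G r ℓ n r = 0 := by
  cases n <;> simp [avoidProb]

lemma avoidProb_nonneg (hℓ : ∀ e ∈ G.edgeSet, 0 < ℓ e) (n : ℕ) :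
    ∀ v, 0 ≤ avoidProb G r ℓ n v := by
  induction n with
  | zero => intro v; rw [avoidProb_zero]; split_ifs <;> norm_num
  | succ n ih =>
    intro v
    rw [avoidProb_succ]
    split_ifs
    · exact le_rfl
    · exact stepAverage_nonneg hℓ ih v

lemma avoidProb_succ_le [Nontrivial V] (hG : G.IsTree) (hℓ : ∀ e ∈ G.edgeSet, 0 < ℓ e) (n : ℕ) :
    ∀ v, avoidProb G r ℓ (n + 1) v ≤ avoidProb G r ℓ n v := by
  induction n with
  | zero =>
    intro v
    rw [avoidProb_succ, avoidProb_zero]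
    split_ifs
    · exact le_rfl
    · refine (stepAverage_mono hℓ (g := fun _ => 1) (fun w => ?_) v).trans
        (stepAverage_one hG hℓ v).le
      rw [avoidProb_zero]
      split_ifs <;> norm_num
  | succ n ih =>
    intro v
    rw [avoidProb_succ, avoidProb_succ n]
    split_ifs
    · exact le_rfl
    · exact stepAverage_mono hℓ ih v

/-- The escape probability as a limit of the avoidance probabilities. -/
lemma exists_tendsto_avoidProb [Nontrivial V] (hG : G.IsTree) (hℓ : ∀ e ∈ G.edgeSet, 0 < ℓ e) :
    ∃ g : V → ℝ, (∀ v, Tendsto (fun n => avoidProb G r ℓ n v) atTop (𝓝 (g v))) ∧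
      g r = 0 ∧ (∀ v, 0 ≤ g v) ∧ (∀ v, g v ≤ 1) ∧ ∀ v, v ≠ r → g v = stepAverage G ℓ g v := by
  have hanti : ∀ v, Antitone fun n => avoidProb G r ℓ n v := fun v =>
    antitone_nat_of_succ_le fun n => avoidProb_succ_le hG hℓ n v
  have hlim : ∀ v, ∃ x, Tendsto (fun n => avoidProb G r ℓ n v) atTop (𝓝 x) := fun v =>
    ⟨_, tendsto_atTop_ciInf (hanti v)
      ⟨0, by rintro _ ⟨n, rfl⟩; exact avoidProb_nonneg hℓ n v⟩⟩
  choose g hg using hlim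
  refine ⟨g, hg, ?_, fun v => ge_of_tendsto' (hg v) fun n => avoidProb_nonneg hℓ n v,
    fun v => le_of_tendsto' (hg v) fun n => (hanti v (Nat.zero_le n)).trans ?_, fun v hv => ?_⟩
  · refine tendsto_nhds_unique (hg r) ?_
    simp only [avoidProb_root]
    exact tendsto_const_nhds
  · change avoidProb G r ℓ 0 v ≤ 1
    rw [avoidProb_zero]
    split_ifs <;> norm_num
  · refine tendsto_nhds_unique ((tendsto_add_atTop_iff_nat 1).2 (hg v)) ?_
    simp only [avoidProb_succ, if_neg hv]
    exact tendsto_stepAverage hg v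

/-- A positive escape probability yields a flow with bounded potential: the gradient of the
escape probability. -/
lemma exists_isPotentialFlow [Nontrivial V] (hG : G.IsTree) (hℓ : ∀ e ∈ G.edgeSet, 0 < ℓ e)
    {g : V → ℝ} (h0 : g r = 0) (hnonneg : ∀ v, 0 ≤ g v) (hle : ∀ v, g v ≤ 1)
    (hharm : ∀ v, v ≠ r → g v = stepAverage G ℓ g v) (hpos : 0 < stepAverage G ℓ g r) :
    ∃ θ : V → ℝ, IsPotentialFlow G r ℓ g θ ∧ 0 < θ r := by
  classical
  let θ : V → ℝ := fun v => if v = r then totalConductance G ℓ r * stepAverage G ℓ g r else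
    (ℓ s(parent G r v, v))⁻¹ * (g v - g (parent G r v))
  have hθ : ∀ u v, IsChild G r u v → θ v = (ℓ s(u, v))⁻¹ * (g v - g u) := by
    intro u v h
    simp only [θ, if_neg h.ne_root, h.parent_eq hG]
  refine ⟨θ, ⟨h0, hnonneg, hle, fun v => ?_, fun u v h => ?_⟩, ?_⟩
  · have h1 : ∑ w ∈ children G r v, θ w =
        -∑ w ∈ children G r v, (ℓ s(v, w))⁻¹ * (g v - g w) := by
      rw [← Finset.sum_neg_distrib]
      refine Finset.sum_congr rfl fun w hw => ?_
      rw [hθ v w (mem_children.1 hw)]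
      ring
    have h2 := sum_sub_eq_totalConductance_mul hG hℓ g v
    by_cases hv : v = r
    · subst hv
      rw [sum_neighborFinset_root hG, h0] at h2
      rw [h1, h0, h2]
      simp [θ]
    · rw [sum_neighborFinset_of_ne hG hv, ← hharm v hv, sub_self, mul_zero] at h2
      rw [h1, hθ _ v (isChild_parent hG hv), Sym2.eq_swap]
      linarith
  · rw [hθ u v h, mul_inv_cancel_left₀ (hℓ _ h.1).ne']
  · simp only [θ, if_true]
    exact mul_pos (totalConductance_pos hG hℓ r) hpos

/-- Linear growth of the factorials bounds the Green function at the root. -/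
lemma sum_returnProb_le [Nontrivial V] (hG : G.IsTree) (hℓ : ∀ e ∈ G.edgeSet, 0 < ℓ e) {h : ℝ}
    (h0 : 0 ≤ h) (hfac : ∀ n : ℕ, n ≠ 0 → factorial G r ℓ n ≤ ENNReal.ofReal (n * h)) (M : ℕ) :
    ∑ n ∈ Finset.range M, returnProb G r ℓ n r ≤ h * totalConductance G ℓ r := by
  classical
  let φ : V → ℝ := fun v => ∑ n ∈ Finset.range M, returnProb G r ℓ n v
  have hφ0 : ∀ v, 0 ≤ φ v := fun v => Finset.sum_nonneg fun n _ => returnProb_nonneg hℓ n v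
  have hφ : ∀ v, M ≤ G.dist r v → φ v = 0 := fun v hv => Finset.sum_eq_zero fun n hn =>
    returnProb_eq_zero hG n v (by rw [Finset.mem_range] at hn; omega)
  let F := (finite_dist_le (r := r) hG M).toFinset
  have hF : ∀ v, v ∈ F ↔ G.dist r v ≤ M := fun v => by
    rw [Set.Finite.mem_toFinset]; rfl
  have hlap : ∀ v, φ v - stepAverage G ℓ φ v =
      (if v = r then 1 else 0) - returnProb G r ℓ M v := by
    intro v
    have h1 : stepAverage G ℓ φ v = ∑ n ∈ Finset.range M, returnProb G r ℓ (n + 1) v := by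
      simp only [returnProb, stepAverage, φ, Finset.mul_sum]
      rw [Finset.sum_comm, Finset.sum_div]
    have h2 := Finset.sum_range_succ (fun n => returnProb G r ℓ n v) M
    rw [Finset.sum_range_succ'] at h2
    have h3 : returnProb G r ℓ 0 v = if v = r then 1 else 0 := returnProb_zero v
    rw [h1, ← h3]
    simp only [φ]
    linarith
  have henergy := sum_sq_div_length (ℓ := ℓ) hG hF hφ
  have hsq := sq_apply_root_le hG hℓ h0 hfac hF hφ0 hφ
  rw [henergy] at hsq
  have hbound : ∑ u ∈ F, φ u * ∑ w ∈ G.neighborFinset u, (ℓ s(u, w))⁻¹ * (φ u - φ w) ≤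
      φ r * totalConductance G ℓ r := by
    have hr : r ∈ F := (hF r).2 (by simp)
    calc _ ≤ ∑ u ∈ F, if u = r then φ r * totalConductance G ℓ r else 0 := by
          refine Finset.sum_le_sum fun u _ => ?_
          rw [sum_sub_eq_totalConductance_mul hG hℓ, hlap]
          have h1 := mul_nonneg (hφ0 u) (mul_nonneg (totalConductance_nonneg hℓ u)
            (returnProb_nonneg (r := r) hℓ M u))
          split_ifs with hu
          · subst hu
            linarith
          · linarith
      _ = _ := by rw [Finset.sum_ite_eq' F r, if_pos hr]
  have h1 : φ r * φ r ≤ φ r * (h * totalConductance G ℓ r) := by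
    have := mul_le_mul_of_nonneg_left hbound h0
    nlinarith
  rcases (hφ0 r).eq_or_lt with h2 | h2
  · change φ r ≤ _
    rw [← h2]
    exact mul_nonneg h0 (totalConductance_nonneg hℓ r)
  · exact le_of_mul_le_mul_left h1 h2

lemma tsum_conductance (hℓ : ∀ e ∈ G.edgeSet, 0 < ℓ e) (v : V) :
    ∑' w, conductance G ℓ v w = ENNReal.ofReal (totalConductance G ℓ v) := by
  rw [totalConductance, ENNReal.ofReal_sum_of_nonneg fun w hw => (inv_length_pos hℓ hw).le,
    tsum_eq_sum (s := G.neighborFinset v)]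
  · refine Finset.sum_congr rfl fun w hw => ?_
    rw [conductance, if_pos ((SimpleGraph.mem_neighborFinset _ _ _).1 hw), one_div]
  · intro w hw
    rw [conductance, if_neg fun h => hw ((SimpleGraph.mem_neighborFinset _ _ _).2 h)]

end average

/-! ### The law of the random walk -/

open Classical in
/-- The indicator of the event that a trajectory is at `r` at time `n`, but not at any of the
`m` following times. -/
noncomputable def lastVisit (r : V) (n m : ℕ) (X : ℕ → V) : ℝ≥0∞ :=
  (if X n = r then 1 else 0) * ∏ i ∈ Finset.range m, if X (n + 1 + i) = r then 0 else 1

lemma lastVisit_congr (r : V) (n m : ℕ) {X Y : ℕ → V} (h : ∀ i ≤ n + m, X i = Y i) :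
    lastVisit r n m X = lastVisit r n m Y := by
  unfold lastVisit
  rw [h n (by omega)]
  congr 1
  refine Finset.prod_congr rfl fun i hi => ?_
  rw [Finset.mem_range] at hi
  rw [h _ (by omega)]

section law

variable [MeasurableSpace V] [DiscreteMeasurableSpace V] {ℓ : Sym2 V → ℝ}

lemma measurableSet_apply_eq (r : V) (n : ℕ) : MeasurableSet {X : ℕ → V | X n = r} :=
  (measurableSet_singleton r).preimage (measurable_pi_apply (X := fun _ : ℕ => V) n)

instance (G : SimpleGraph V) (r : V) (ℓ : Sym2 V → ℝ) : IsProbabilityMeasure (walkLaw G r ℓ) := by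
  unfold walkLaw
  infer_instance

lemma lintegral_apply_zero (f : V → ℝ≥0∞) : ∫⁻ X, f (X 0) ∂(walkLaw G r ℓ) = f r := by
  have hf : Measurable f := Measurable.of_discrete
  have h1 : ∫⁻ X, f (X 0) ∂(walkLaw G r ℓ) = ∫⁻ x, f (x ⟨0, Finset.mem_Iic.2 le_rfl⟩)
      ∂((walkLaw G r ℓ).map (Preorder.frestrictLe (π := fun _ => V) 0)) := by
    rw [lintegral_map (by fun_prop) (by fun_prop)]
    rfl
  rw [h1, walkLaw, Kernel.traj_map_frestrictLe_apply, Kernel.partialTraj_self, Kernel.id_apply,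
    lintegral_dirac' _ (by fun_prop)]

lemma ae_apply_zero : ∀ᵐ X ∂(walkLaw G r ℓ), X 0 = r := by
  classical
  rw [ae_iff]
  change walkLaw G r ℓ {X | X 0 = r}ᶜ = 0
  rw [← lintegral_indicator_one (measurableSet_apply_eq r 0).compl]
  refine Eq.trans (lintegral_congr fun X => ?_) ((lintegral_apply_zero (G := G) (ℓ := ℓ)
    fun v => if v = r then 0 else 1).trans (if_pos rfl))
  by_cases hX : X 0 = r <;> simp [Set.indicator, hX]

/-- The Markov property, for one step and a function `A` of the positions up to time `n`. -/
lemma lintegral_mul_apply_succ {n : ℕ} {A : (ℕ → V) → ℝ≥0∞} (hA : Measurable A)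
    (hdep : ∀ X Y : ℕ → V, (∀ i ≤ n, X i = Y i) → A X = A Y) (f : V → ℝ≥0∞) :
    ∫⁻ X, A X * f (X (n + 1)) ∂(walkLaw G r ℓ) =
      ∫⁻ X, A X * ∫⁻ w, f w ∂(stepPMF G ℓ (X n)).toMeasure ∂(walkLaw G r ℓ) := by
  have hf : Measurable f := Measurable.of_discrete
  let ext : (Finset.Iic n → V) → ℕ → V := fun x i =>
    if h : i ≤ n then x ⟨i, Finset.mem_Iic.2 h⟩ else r
  have hext : Measurable ext := by
    refine measurable_pi_lambda _ fun i => ?_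
    by_cases h : i ≤ n
    · simp only [ext, h, dif_pos]
      fun_prop
    · simp only [ext, h, dif_neg, not_false_iff]
      fun_prop
  have hAext : ∀ X : ℕ → V, A (ext (Preorder.frestrictLe (π := fun _ => V) n X)) = A X := by
    intro X
    refine hdep _ _ fun i hi => ?_
    simp only [ext, dif_pos hi]
    rfl
  have hAm : Measurable fun x => A (ext x) := hA.comp hext
  have hstep : Measurable fun v => ∫⁻ w, f w ∂(stepPMF G ℓ v).toMeasure := Measurable.of_discrete
  have h1 : ∫⁻ X, A X * f (X (n + 1)) ∂(walkLaw G r ℓ) =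
      ∫⁻ p, A (ext p.1) * f p.2 ∂((walkLaw G r ℓ).map
        (fun X => (Preorder.frestrictLe (π := fun _ => V) n X, X (n + 1)))) := by
    rw [lintegral_map (by fun_prop) (by fun_prop)]
    simp only [hAext]
  have h2 : ∫⁻ X, A X * ∫⁻ w, f w ∂(stepPMF G ℓ (X n)).toMeasure ∂(walkLaw G r ℓ) =
      ∫⁻ x, A (ext x) * ∫⁻ w, f w ∂(stepPMF G ℓ (x ⟨n, Finset.mem_Iic.2 le_rfl⟩)).toMeasure
        ∂((walkLaw G r ℓ).map (Preorder.frestrictLe (π := fun _ => V) n)) := by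
    rw [lintegral_map (f := fun x : Finset.Iic n → V => A (ext x) *
      ∫⁻ w, f w ∂(stepPMF G ℓ (x ⟨n, Finset.mem_Iic.2 le_rfl⟩)).toMeasure)
      (hAm.mul (hstep.comp (measurable_pi_apply _))) (by fun_prop)]
    simp only [hAext]
    rfl
  rw [h1, h2, walkLaw, ← Kernel.partialTraj_compProd_eq_map_traj (Nat.zero_le n),
    Kernel.traj_map_frestrictLe_apply, Measure.lintegral_compProd (by fun_prop)]
  refine lintegral_congr fun x => ?_
  change ∫⁻ w, A (ext x) * f w ∂(stepPMF G ℓ (x ⟨n, _⟩)).toMeasure = _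
  exact lintegral_const_mul _ hf

section locallyFinite

variable [G.LocallyFinite]

lemma lintegral_stepPMF [Nontrivial V] (hG : G.IsTree) (hℓ : ∀ e ∈ G.edgeSet, 0 < ℓ e)
    {f : V → ℝ} (hf : ∀ v, 0 ≤ f v) (v : V) :
    ∫⁻ w, ENNReal.ofReal (f w) ∂(stepPMF G ℓ v).toMeasure =
      ENNReal.ofReal (stepAverage G ℓ f v) := by
  have := countable_of_isTree hG v
  have hpos := totalConductance_pos hG hℓ v
  have h0 : ∑' w, conductance G ℓ v w ≠ 0 ∧ ∑' w, conductance G ℓ v w ≠ ∞ := by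
    rw [tsum_conductance hℓ]
    exact ⟨by simpa using hpos, ENNReal.ofReal_ne_top⟩
  rw [lintegral_countable', stepPMF, dif_pos h0, stepAverage, div_eq_mul_inv, Finset.sum_mul,
    ENNReal.ofReal_sum_of_nonneg fun w hw =>
      mul_nonneg (mul_nonneg (inv_length_pos hℓ hw).le (hf w)) (inv_nonneg.2 hpos.le),
    tsum_eq_sum (s := G.neighborFinset v)]
  · refine Finset.sum_congr rfl fun w hw => ?_
    have hc := inv_length_pos hℓ hw
    rw [PMF.toMeasure_apply_singleton _ _ (measurableSet_singleton w), PMF.normalize_apply,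
      tsum_conductance hℓ, conductance, if_pos ((SimpleGraph.mem_neighborFinset _ _ _).1 hw),
      one_div, ENNReal.ofReal_mul (mul_nonneg hc.le (hf w)), ENNReal.ofReal_mul hc.le,
      ENNReal.ofReal_inv_of_pos hpos]
    ring
  · intro w hw
    rw [PMF.toMeasure_apply_singleton _ _ (measurableSet_singleton w), PMF.normalize_apply,
      conductance, if_neg fun h => hw ((SimpleGraph.mem_neighborFinset _ _ _).2 h), zero_mul,
      mul_zero]

lemma lintegral_returnProb [Nontrivial V] (hG : G.IsTree) (hℓ : ∀ e ∈ G.edgeSet, 0 < ℓ e)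
    (n : ℕ) : ∀ k, ∫⁻ X, ENNReal.ofReal (returnProb G r ℓ k (X n)) ∂(walkLaw G r ℓ) =
      ENNReal.ofReal (returnProb G r ℓ (n + k) r) := by
  induction n with
  | zero =>
    intro k
    rw [lintegral_apply_zero fun v => ENNReal.ofReal (returnProb G r ℓ k v), Nat.zero_add]
  | succ n ih =>
    intro k
    have h := lintegral_mul_apply_succ (G := G) (r := r) (ℓ := ℓ) (n := n) (A := fun _ => 1)
      measurable_const (fun _ _ _ => rfl) fun v => ENNReal.ofReal (returnProb G r ℓ k v)
    simp only [one_mul, lintegral_stepPMF hG hℓ (returnProb_nonneg hℓ k)] at h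
    rw [h, Nat.succ_add_eq_add_succ, ← ih (k + 1)]
    rfl

lemma walkLaw_apply_eq_root [Nontrivial V] (hG : G.IsTree) (hℓ : ∀ e ∈ G.edgeSet, 0 < ℓ e)
    (n : ℕ) : walkLaw G r ℓ {X | X n = r} = ENNReal.ofReal (returnProb G r ℓ n r) := by
  classical
  have h := lintegral_returnProb (r := r) hG hℓ n 0
  rw [Nat.add_zero] at h
  rw [← h, ← lintegral_indicator_one (measurableSet_apply_eq r n)]
  refine lintegral_congr fun X => ?_
  by_cases hX : X n = r <;> simp [returnProb, Set.indicator, hX]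

/-- A finite Green function implies transience, by the Borel–Cantelli lemma. -/
lemma transient_of_sum_returnProb_le [Nontrivial V] (hG : G.IsTree)
    (hℓ : ∀ e ∈ G.edgeSet, 0 < ℓ e) {C : ℝ}
    (hC : ∀ M, ∑ n ∈ Finset.range M, returnProb G r ℓ n r ≤ C) : Transient G r ℓ := by
  refine ae_finite_setOfPred_mem (s := fun n => {X : ℕ → V | X n = r}) ?_
  refine ne_top_of_le_ne_top (ENNReal.ofReal_ne_top (r := C)) ?_
  rw [ENNReal.tsum_eq_iSup_nat]
  refine iSup_le fun M => ?_
  simp only [walkLaw_apply_eq_root hG hℓ]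
  rw [← ENNReal.ofReal_sum_of_nonneg fun n _ => returnProb_nonneg hℓ n r]
  exact ENNReal.ofReal_le_ofReal (hC M)

lemma measurable_lastVisit (r : V) (n m : ℕ) : Measurable (lastVisit r n m) := by
  classical
  have h1 : Measurable fun v : V => if v = r then (1 : ℝ≥0∞) else 0 := Measurable.of_discrete
  have h2 : Measurable fun v : V => if v = r then (0 : ℝ≥0∞) else 1 := Measurable.of_discrete
  unfold lastVisit
  exact (h1.comp (measurable_pi_apply n)).mul (Finset.measurable_fun_prod _ fun i _ =>
    h2.comp (measurable_pi_apply (n + 1 + i)))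

/-- The probability of a visit to the root at time `n` that is not followed by another visit
during the next `k + 1` steps. -/
lemma lintegral_lastVisit_le [Nontrivial V] (hG : G.IsTree) (hℓ : ∀ e ∈ G.edgeSet, 0 < ℓ e)
    (n k : ℕ) : ∫⁻ X, lastVisit r n (k + 1) X ∂(walkLaw G r ℓ) ≤
      ENNReal.ofReal (stepAverage G ℓ (avoidProb G r ℓ k) r) := by
  classical
  have hmarkov : ∀ m k, ∫⁻ X, lastVisit r n m X *
        ENNReal.ofReal (avoidProb G r ℓ k (X (n + m + 1))) ∂(walkLaw G r ℓ) =
      ∫⁻ X, lastVisit r n m X *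
        ENNReal.ofReal (stepAverage G ℓ (avoidProb G r ℓ k) (X (n + m))) ∂(walkLaw G r ℓ) := by
    intro m k
    rw [lintegral_mul_apply_succ (n := n + m) (measurable_lastVisit r n m)
      (fun X Y h => lastVisit_congr r n m h) fun v => ENNReal.ofReal (avoidProb G r ℓ k v)]
    simp only [lintegral_stepPMF hG hℓ (avoidProb_nonneg hℓ k)]
  -- Each step forward turns a factor of the recursion for `avoidProb` into one of `lastVisit`.
  have hshift : ∀ k m, ∫⁻ X, lastVisit r n (m + k + 1) X ∂(walkLaw G r ℓ) =
      ∫⁻ X, lastVisit r n m X *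
        ENNReal.ofReal (avoidProb G r ℓ k (X (n + m + 1))) ∂(walkLaw G r ℓ) := by
    intro k
    induction k with
    | zero =>
      intro m
      refine lintegral_congr fun X => ?_
      rw [lastVisit, Nat.add_zero, Finset.prod_range_succ, ← mul_assoc, add_right_comm n 1 m]
      by_cases hX : X (n + m + 1) = r <;> simp [avoidProb_zero, hX, lastVisit]
    | succ k ih =>
      intro m
      rw [show m + (k + 1) + 1 = (m + 1) + k + 1 by omega, ih (m + 1), hmarkov]
      refine lintegral_congr fun X => ?_
      rw [lastVisit, Finset.prod_range_succ, ← mul_assoc, add_right_comm n 1 m, ← add_assoc,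
        avoidProb_succ]
      by_cases hX : X (n + m + 1) = r <;> simp [hX, lastVisit]
  have h := hshift k 0
  rw [Nat.zero_add, hmarkov 0 k] at h
  rw [h]
  calc _ ≤ ∫⁻ _, ENNReal.ofReal (stepAverage G ℓ (avoidProb G r ℓ k) r) ∂(walkLaw G r ℓ) := by
        refine lintegral_mono fun X => ?_
        by_cases hX : X n = r <;> simp [lastVisit, hX]
    _ = _ := by simp

/-- A transient walk escapes from the root with positive probability: otherwise almost surely no
visit to the root would be the last one. -/
lemma Transient.stepAverage_pos [Nontrivial V] (hG : G.IsTree) (hℓ : ∀ e ∈ G.edgeSet, 0 < ℓ e)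
    (h : Transient G r ℓ) {g : V → ℝ}
    (hg : ∀ v, Tendsto (fun n => avoidProb G r ℓ n v) atTop (𝓝 (g v))) :
    0 < stepAverage G ℓ g r := by
  classical
  have hlim := tendsto_stepAverage (G := G) (ℓ := ℓ) hg r
  refine lt_of_le_of_ne (ge_of_tendsto' hlim fun n =>
    stepAverage_nonneg hℓ (avoidProb_nonneg hℓ n) r) fun h0 => ?_
  rw [← h0] at hlim
  have hlast : ∀ n, walkLaw G r ℓ {X | X n = r ∧ ∀ i, X (n + 1 + i) ≠ r} = 0 := by
    intro n
    have hlim' := ENNReal.tendsto_ofReal hlim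
    rw [ENNReal.ofReal_zero] at hlim'
    refine le_antisymm (ge_of_tendsto' hlim' fun k => ?_) zero_le
    refine le_trans ?_ (lintegral_lastVisit_le hG hℓ n k)
    have hmeas : MeasurableSet {X : ℕ → V | X n = r ∧ ∀ i, X (n + 1 + i) ≠ r} := by
      have hset : {X : ℕ → V | X n = r ∧ ∀ i, X (n + 1 + i) ≠ r} =
          {X | X n = r} ∩ ⋂ i, {X : ℕ → V | X (n + 1 + i) = r}ᶜ := by
        ext X
        simp
      rw [hset]
      exact (measurableSet_apply_eq r n).inter
        (MeasurableSet.iInter fun i => (measurableSet_apply_eq r _).compl)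
    rw [← lintegral_indicator_one hmeas]
    refine lintegral_mono fun X => ?_
    by_cases hX : X ∈ {X : ℕ → V | X n = r ∧ ∀ i, X (n + 1 + i) ≠ r}
    · have hX' : X n = r ∧ ∀ i, X (n + 1 + i) ≠ r := hX
      rw [Set.indicator_of_mem hX]
      simp [lastVisit, hX'.1, hX'.2]
    · rw [Set.indicator_of_notMem hX]
      exact zero_le
  have hae : ∀ᵐ X ∂(walkLaw G r ℓ), ∀ n, ¬ (X n = r ∧ ∀ i, X (n + 1 + i) ≠ r) :=
    ae_all_iff.2 fun n => by
      rw [ae_iff]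
      simpa only [not_not] using hlast n
  obtain ⟨X, hfin, hX, hX0⟩ := (h.and (hae.and ae_apply_zero)).exists
  obtain ⟨m, hm, hmax⟩ := hfin.toFinset.exists_max_image id ⟨0, hfin.mem_toFinset.2 hX0⟩
  refine hX m ⟨hfin.mem_toFinset.1 hm, fun i hi => ?_⟩
  have := hmax (m + 1 + i) (hfin.mem_toFinset.2 hi)
  simp only [id] at this
  omega

end locallyFinite

end law

end RootedTree

theorem mainTheorem2 {V : Type*} [MeasurableSpace V] [DiscreteMeasurableSpace V] [Infinite V]
    (G : SimpleGraph V) [G.LocallyFinite] (hG : G.IsTree) (r : V)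
    (ℓ : Sym2 V → ℝ) (hℓ : ∀ e ∈ G.edgeSet, 0 < ℓ e)
    (hwc : RootedTree.WeaklyComplete G r ℓ) :
    (∀ (n : ℕ) (ρ : ℕ → RootedTree.ExtBoundary G r), RootedTree.IsFactorialDefining ℓ ρ n →
      ∑ j ∈ Finset.range n, RootedTree.pairing ℓ (ρ n) (ρ j) = RootedTree.factorial G r ℓ n) ∧
    ∃ H : ℝ≥0∞,
      Tendsto (fun n : ℕ => RootedTree.factorial G r ℓ n / (n : ℝ≥0∞)) atTop (𝓝 H) ∧
      (RootedTree.Transient G r ℓ ↔ H < ∞) ∧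
      (RootedTree.Recurrent G r ℓ ↔ H = ∞) := by
  refine ⟨fun n ρ hρ => hρ.sum_eq_factorial hG, ?_⟩
  obtain ⟨H, hH, hle⟩ := RootedTree.exists_tendsto_div_of_superadditive
    (RootedTree.factorial G r ℓ) (RootedTree.factorial_add_le hG ℓ)
  have hiff : RootedTree.Transient G r ℓ ↔ H < ∞ := by
    constructor
    · intro h
      obtain ⟨g, hg, h0, hnonneg, hle1, hharm⟩ :=
        RootedTree.exists_tendsto_avoidProb (r := r) hG hℓ
      obtain ⟨θ, hθ, hpos⟩ := RootedTree.exists_isPotentialFlow hG hℓ h0 hnonneg hle1 hharm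
        (h.stepAverage_pos hG hℓ hg)
      refine lt_of_le_of_lt (le_of_tendsto' hH fun n => ?_)
        (ENNReal.ofReal_lt_top (r := 1 / θ r))
      refine ENNReal.div_le_of_le_mul ((hθ.factorial_le hG hℓ hwc hpos n).trans_eq ?_)
      rw [← ENNReal.ofReal_natCast, ← ENNReal.ofReal_mul (by positivity)]
      congr 1
      ring
    · intro h
      refine RootedTree.transient_of_sum_returnProb_le hG hℓ
        (RootedTree.sum_returnProb_le hG hℓ ENNReal.toReal_nonneg (h := H.toReal) fun n hn => ?_)
      rw [ENNReal.ofReal_mul (Nat.cast_nonneg n), ENNReal.ofReal_natCast,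
        ENNReal.ofReal_toReal h.ne]
      exact hle n hn
  refine ⟨H, hH, hiff, ?_⟩
  rw [RootedTree.Recurrent, hiff, not_lt, top_le_iff]
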